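/- Let $K$ be a finite tetrahedral mesh in $\mathbb{R}^3$ (a finite geometric simplicial complex in which every simplex is a face of a tetrahedron), and for a simplex $s$ let $c_s$ be its circumcenter. Assume that $K$ is nondegenerate pairwise Delaunay: whenever two distinct tetrahedra $\rho,\lambda$ of $K$ share a triangle $\sigma$, the vertex of $\lambda$ opposite to $\sigma$ lies strictly outside the circumsphere of $\rho$. (This holds in particular for every Delaunay mesh, i.e. one with no vertex inside the circumsphere of a tetrahedron, in which no two adjacent tetrahedra have the same circumsphere.) Let $\tau$ be an internal edge of $K$, i.e. every triangle of $K$ that contains $\tau$ is shared by two tetrahedra of $K$. Then the circumcentric dual $\star\tau$ is a simple, planar, convex polygon. That is, for some $n\ge 3$ the tetrahedra incident to $\tau$ can be listed without repetition as $\rho_0,\dots,\rho_{n-1}$, and the triangles incident to $\tau$ as $\sigma_0,\dots,\sigma_{n-1}$, with $\sigma_i\prec\rho_i$ and $\sigma_i\prec\rho_{i+1}$ (indices mod $n$), and the closed polygon with vertices $c_{\rho_0},\dots,c_{\rho_{n-1}}$ in this order lies in a plane, is simple (its vertices are distinct and two different sides meet at most in a common endpoint of consecutive sides), and is convex (for every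 side, all vertices other than its endpoints lie strictly on the same side of the line through it). Moreover, the signed area of $\star\tau$ is positive: $$\sum_{\tau\prec\sigma\prec\rho} s(\tau,\sigma)\,s(\sigma,\rho)\,\operatorname{area}\bigl(\triangle\, c_\tau c_\sigma c_\rho\bigr)>0 ,$$ where the sum is over all triangles $\sigma$ and tetrahedra $\rho$ of $K$ with $\tau\prec\sigma\prec\rho$, the area is the ordinary unsigned area, and for a simplex $b=v*a$ (the join of its face $a$ with a vertex $v$) the sign $s(a,b)$ is $+1$ if $c_b$ lies in the same open half space as $v$ relative to $a$ in the affine span of $b$, and $-1$ otherwise. -/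

import Mathlib

/-- Euclidean three-space. -/
abbrev E3 : Type := EuclideanSpace ℝ (Fin 3)

namespace CircumcentricDual

open Geometry

/-- The faces of `K` with exactly `k` vertices (so of dimension `k - 1`) that have `s` as a face. -/
def incident (K : SimplicialComplex ℝ E3) (s : Finset E3) (k : ℕ) : Set (Finset E3) :=
  {t | t ∈ K.faces ∧ s ⊆ t ∧ t.card = k}

/-- A tetrahedral mesh: a finite simplicial complex in three-space in which every simplex is a face
of a tetrahedron of the complex. -/
structure IsTetrahedralMesh (K : SimplicialComplex ℝ E3) : Prop where
  finite : K.faces.Finite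
  pure : ∀ s ∈ K.faces, (incident K s 4).Nonempty

/-- An edge `τ` is internal if it does not lie in a boundary triangle, a
boundary triangle being one that is a face of only one tetrahedron. -/
def IsInternal (K : SimplicialComplex ℝ E3) (τ : Finset E3) : Prop :=
  ∀ σ ∈ incident K τ 3, (incident K σ 4).Nontrivial

open Classical in
/-- The circumsphere of the simplex with vertex set `s`: the unique sphere through the vertices
whose center lies in the affine span of `s`. It is built exactly as
`Affine.Simplex.circumsphere`, but without a chosen order on the vertices. The value is
irrelevant if `s` is not the vertex set of a simplex. -/
noncomputable def circumsphere (s : Finset E3) : EuclideanGeometry.Sphere E3 :=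
  if h : Nonempty s ∧ AffineIndependent ℝ ((↑) : s → E3) then
    (haveI := h.1; h.2.existsUnique_dist_eq.choose)
  else ⟨0, 0⟩

/-- The circumcenter of the simplex with vertex set `s`. -/
noncomputable def circumcenter (s : Finset E3) : E3 := (circumsphere s).center

/-- The circumradius of the simplex with vertex set `s`. -/
noncomputable def circumradius (s : Finset E3) : ℝ := (circumsphere s).radius

/-- The mesh is (nondegenerate, pairwise) Delaunay: whenever two different tetrahedra `ρ`, `lam`
share a triangle `σ`, the vertex of `lam` opposite to `σ` lies strictly outside the circumsphere
of `ρ`. This holds in particular if no vertex of the mesh is inside a circumsphere of a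
tetrahedron and adjacent tetrahedra are not cospherical. -/
def IsPairwiseDelaunay (K : SimplicialComplex ℝ E3) : Prop :=
  ∀ σ ∈ K.faces, σ.card = 3 → ∀ ρ ∈ incident K σ 4, ∀ lam ∈ incident K σ 4, ρ ≠ lam →
    ∀ v ∈ lam, v ∉ σ → circumradius ρ < dist v (circumcenter ρ)

open Classical in
/-- For `σ = v * τ`, the sign is `+1` if the circumcenter of `σ` is on the same side of (the affine
span of) `τ` as `v`, and `-1` otherwise. -/
noncomputable def stepSign (τ σ : Finset E3) : ℝ :=
  if ∀ v ∈ σ, v ∉ τ → (affineSpan ℝ (τ : Set E3)).SSameSide (circumcenter σ) v then 1 else -1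

/-- The (unsigned) area of the triangle `abc`. -/
noncomputable def triangleArea (a b c : E3) : ℝ :=
  1 / 2 * dist a b * dist c b * Real.sin (EuclideanGeometry.angle a b c)

/-- The signed area of the elementary dual triangle `c_τ, c_σ, c_ρ` of an edge `τ`, for a triangle
`σ` and a tetrahedron `ρ` with `τ ≺ σ ≺ ρ`. -/
noncomputable def elementaryArea (τ σ ρ : Finset E3) : ℝ :=
  stepSign τ σ * stepSign σ ρ *
    triangleArea (circumcenter τ) (circumcenter σ) (circumcenter ρ)

/-- The signed area of the dual of the edge `τ`: the sum of the signed areas of its elementary dual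
triangles, over all chains `τ ≺ σ ≺ ρ` of a triangle and a tetrahedron of `K`. -/
noncomputable def dualSignedArea (K : SimplicialComplex ℝ E3) (τ : Finset E3) : ℝ :=
  ∑ᶠ σ ∈ incident K τ 3, ∑ᶠ ρ ∈ incident K σ 4, elementaryArea τ σ ρ

/-- `P` is the circumcentric dual of the edge `τ`: its vertices are the circumcenters of the
tetrahedra `ρ i` incident to `τ`, each listed once, and its sides are the dual edges of the
triangles `σ i` incident to `τ`, each listed once; the `i`-th side joins the circumcenters of
`ρ i` and `ρ (i + 1)` (cyclically), which share the triangle `σ i`. -/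
def IsDualPolygon (K : SimplicialComplex ℝ E3) (τ : Finset E3) {n : ℕ} (P : Polygon E3 n) : Prop :=
  ∃ ρ σ : Fin n → Finset E3,
    Set.BijOn ρ Set.univ (incident K τ 4) ∧
    Set.BijOn σ Set.univ (incident K τ 3) ∧
    (∀ i, σ i ⊆ ρ i ∧ σ i ⊆ ρ (finRotate n i)) ∧
    ∀ i, P i = circumcenter (ρ i)

/-- A simple polygon: it has at least three vertices, they are distinct, and two different sides
meet at most in a common endpoint of consecutive sides. -/
def IsSimple {n : ℕ} (P : Polygon E3 n) : Prop :=
  3 ≤ n ∧ Function.Injective P.vertices ∧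
    ∀ i j, i ≠ j → ∀ x ∈ P.edgeSet ℝ i ∩ P.edgeSet ℝ j,
      (j = finRotate n i ∧ x = P j) ∨ (i = finRotate n j ∧ x = P i)

/-- A planar polygon: its vertices (hence its sides) lie in a plane. -/
def IsPlanar {n : ℕ} (P : Polygon E3 n) : Prop :=
  Coplanar ℝ (Set.range P.vertices)

/-- A (planar, simple) polygon is convex if, for every side, all vertices that are not endpoints of
the side are strictly on the same side of the line through it. -/
def IsConvex {n : ℕ} (P : Polygon E3 n) : Prop :=
  ∀ i j k, j ≠ i → j ≠ finRotate n i → k ≠ i → k ≠ finRotate n i →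
    (affineSpan ℝ {P i, P (finRotate n i)}).SSameSide (P j) (P k)

end CircumcentricDual

/-!
All circumcenters of simplices containing the edge `τ = pq` are equidistant from `p` and `q`, so
they lie in the perpendicular bisector of `pq`. In coordinates with the midpoint of `pq` as origin
(`EdgeFrame`), let `w v` be the projection of a vertex `v` to that plane. A point `z` of the plane
is equidistant from `p` and `v` exactly when `⟨z, w v⟩ = b v`, for a number `b v` depending on `v`
only, and it is nearer to `p` than to `v` exactly when `⟨z, w v⟩ < b v` (`EdgeFrame.dist_eq_iff`,
`EdgeFrame.dist_lt_iff`). So the circumcenter of the tetrahedron `pqvy` is the intersection of two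
lines, and the Delaunay condition becomes a linear inequality.

Because simplices of the mesh meet only in common faces, the sector between `w v` and `w y` for a
tetrahedron `pqvy` contains no other projected vertex (`IsSector.eq_or_eq`). As `τ` is internal,
each triangle at `τ` has one tetrahedron on each side. Sorting the vertices by argument then shows
that the tetrahedra around `τ` form a single cycle making one full turn (`exists_isTurn`,
`exists_isLinkCycle`).

The step from one circumcenter to the next is perpendicular to the normal vector `w v` of the
triangle crossed, and the local Delaunay condition says that it is a positive multiple of `w v`
turned by a right angle (`IsLinkCycle.side_pos`). The inner product with a fixed `w v` therefore
falls while the steps have turned by less than half a turn and rises afterwards, so it stays below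
`b v` except at the two ends of the side belonging to `v` (`IsTurn.dot_lt`). Every side thus spans
a supporting line touching no other vertex, which gives simplicity and convexity.

For the signed area, the two elementary triangles at a triangle `σ` add up to half of `l b`, where
`l` is the signed length of the corresponding side in units of its normal vector and `b` its level
(`IsLinkCycle.elementaryArea_add`). As the sides of a closed polygon add up to zero, the apex may
be moved to a vertex of the polygon, where each term is nonnegative and some are positive
(`IsLinkCycle.dualSignedArea_pos`).
-/

namespace CircumcentricDual

open Geometry

/-! ### Plane vectors in angular order -/

/-- The inner product of two plane vectors, in coordinates. -/
def dot (z w : ℂ) : ℝ := z.re * w.re + z.im * w.im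

/-- The determinant of two plane vectors: positive when `w` is a counterclockwise turn by an angle
in `(0, π)` away from `z`. -/
def cross (z w : ℂ) : ℝ := z.re * w.im - z.im * w.re

lemma cross_self (z : ℂ) : cross z z = 0 := by simp only [cross]; ring

lemma cross_swap (z w : ℂ) : cross z w = -cross w z := by simp only [cross]; ring

lemma cross_eq_sin (z w : ℂ) : cross z w = ‖z‖ * ‖w‖ * Real.sin (w.arg - z.arg) := by
  rw [Real.sin_sub]
  have h1 := Complex.norm_mul_cos_arg z
  have h2 := Complex.norm_mul_sin_arg z
  have h3 := Complex.norm_mul_cos_arg w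
  have h4 := Complex.norm_mul_sin_arg w
  rw [cross, ← h1, ← h2, ← h3, ← h4]
  ring

lemma norm_pos_of_cross_pos {z w : ℂ} (h : 0 < cross z w) : 0 < ‖z‖ := by
  rw [norm_pos_iff]
  rintro rfl
  simp [cross] at h

lemma eq_of_dot_eq_of_cross_eq {z w x : ℂ} (hz : 0 < dot z z) (hd : dot z w = dot z x)
    (hc : cross z w = cross z x) : w = x := by
  simp only [dot, cross] at *
  apply Complex.ext
  · have : (z.re * z.re + z.im * z.im) * (w.re - x.re) = 0 := by
      linear_combination z.re * hd - z.im * hc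
    rcases mul_eq_zero.1 this with h | h <;> linarith
  · have : (z.re * z.re + z.im * z.im) * (w.im - x.im) = 0 := by
      linear_combination z.im * hd + z.re * hc
    rcases mul_eq_zero.1 this with h | h <;> linarith

lemma dot_self_pos {z : ℂ} (hz : z ≠ 0) : 0 < dot z z := by
  have := Complex.normSq_pos.2 hz
  rwa [Complex.normSq_apply] at this

/-- A cyclic sequence of plane vectors in counterclockwise order making one full turn every `n`
steps: `θ` lists their arguments without reduction modulo `2π`. -/
structure IsTurn (n : ℕ) (w : ℕ → ℂ) (θ : ℕ → ℝ) : Prop where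
  strictMono : StrictMono θ
  add_period : ∀ i, θ (i + n) = θ i + 2 * Real.pi
  periodic : ∀ i, w (i + n) = w i
  cross_eq : ∀ i j, cross (w i) (w j) = ‖w i‖ * ‖w j‖ * Real.sin (θ j - θ i)
  cross_pos : ∀ i, 0 < cross (w i) (w (i + 1))

namespace IsTurn

variable {n : ℕ} {w : ℕ → ℂ} {θ : ℕ → ℝ}

lemma sub_lt_two_pi (h : IsTurn n w θ) {i k : ℕ} (hk : k < n) : θ (i + k) - θ i < 2 * Real.pi := by
  have := h.strictMono (show i + k < i + n by omega)
  rw [h.add_period] at this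
  linarith

lemma norm_pos (h : IsTurn n w θ) (i : ℕ) : 0 < ‖w i‖ := norm_pos_of_cross_pos (h.cross_pos i)

lemma cross_nonneg_iff (h : IsTurn n w θ) (i j : ℕ) :
    0 ≤ cross (w i) (w j) ↔ 0 ≤ Real.sin (θ j - θ i) := by
  rw [h.cross_eq]
  exact mul_nonneg_iff_of_pos_left (mul_pos (h.norm_pos i) (h.norm_pos j))

lemma period_pos (h : IsTurn n w θ) : 0 < n := by
  rcases Nat.eq_zero_or_pos n with rfl | hn
  · have := h.add_period 0
    have := Real.pi_pos
    simp at *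
  · exact hn

lemma three_le (h : IsTurn n w θ) : 3 ≤ n := by
  have h0 := h.period_pos
  by_contra! hn
  have h1 := h.cross_pos 0
  have h2 := h.cross_pos 1
  have h3 := h.periodic 0
  interval_cases n
  · simp only [zero_add] at h3
    simp [h3, cross_self] at h1
  · simp only [zero_add] at h3
    simp only [zero_add, Nat.reduceAdd, h3] at h1 h2
    rw [cross_swap] at h2
    linarith

/-- Along the path `c`, whose `i`-th step is a positive multiple of the normal vector `w i` turned
by a right angle, the function `dot · (w i)` decreases as long as the steps have turned by less than
a half turn from `w i`, and increases afterwards. Hence it is maximal exactly at the two ends of the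
step along its own level line. -/
theorem dot_lt (h : IsTurn n w θ) {c : ℕ → ℂ} {b l : ℕ → ℝ} (hc : ∀ i, c (i + n) = c i)
    (hl : ∀ i, 0 < l i)
    (hstep : ∀ i x, dot (c (i + 1)) x = dot (c i) x + l i * cross (w (i + 1)) x)
    (hb : ∀ i, dot (c i) (w i) = b i) (hb' : ∀ i, dot (c i) (w (i + 1)) = b (i + 1))
    (i : ℕ) {k : ℕ} (hk : 1 ≤ k) (hkn : k + 2 ≤ n) : dot (c (i + k)) (w i) < b i := by
  have step : ∀ k, dot (c (i + (k + 1))) (w i) =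
      dot (c (i + k)) (w i) - l (i + k) * cross (w i) (w (i + (k + 1))) := by
    intro k
    rw [← add_assoc, hstep, cross_swap]
    ring
  have hpos : ∀ k, 1 ≤ k → 0 < θ (i + k) - θ i := fun k hk ↦
    sub_pos.2 (h.strictMono (by omega))
  rcases le_total (θ (i + k) - θ i) Real.pi with hle | hge
  · have key : ∀ k, 1 ≤ k → θ (i + k) - θ i ≤ Real.pi → dot (c (i + k)) (w i) < b i := by
      intro k hk
      induction k, hk using Nat.le_induction with
      | base =>
        intro _
        have h1 := step 0
        have h2 := mul_pos (hl i) (h.cross_pos i)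
        simp only [zero_add, add_zero] at h1
        rw [h1, hb]
        linarith
      | succ k hk ih =>
        intro hle
        have h1 := h.strictMono (show i + k < i + (k + 1) by omega)
        have h2 := ih (by linarith)
        have h3 : 0 ≤ cross (w i) (w (i + (k + 1))) :=
          (h.cross_nonneg_iff _ _).2 (Real.sin_nonneg_of_nonneg_of_le_pi (hpos _ (by omega)).le hle)
        rw [step]
        have := mul_nonneg (hl (i + k)).le h3
        linarith
    exact key k hk hle
  · have last : ∀ k, k + 1 = n → dot (c (i + k)) (w i) = b i := by
      intro k hk
      have h1 : i + k + 1 = i + n := by omega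
      have h2 := hb' (i + k)
      have h3 := hb (i + n)
      rwa [h1, h.periodic, ← h3, h.periodic, hc, hb] at h2
    have neg : ∀ k, k + 1 < n → Real.pi ≤ θ (i + k) - θ i →
        cross (w i) (w (i + (k + 1))) < 0 := by
      intro k hk hge
      have h1 := h.strictMono (show i + k < i + (k + 1) by omega)
      have h2 := h.sub_lt_two_pi (i := i) hk
      rw [h.cross_eq]
      refine mul_neg_of_pos_of_neg (mul_pos (h.norm_pos _) (h.norm_pos _)) ?_
      rw [← Real.sin_sub_two_pi]
      exact Real.sin_neg_of_neg_of_neg_pi_lt (by linarith) (by linarith)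
    have key : ∀ d k, 1 ≤ k → k + 2 + d = n → Real.pi ≤ θ (i + k) - θ i →
        dot (c (i + k)) (w i) < b i := by
      intro d
      induction d with
      | zero =>
        intro k hk hn hge
        have h3 := neg k (by omega) hge
        have h4 := step k
        rw [last (k + 1) (by omega)] at h4
        have := mul_neg_of_pos_of_neg (hl (i + k)) h3
        linarith
      | succ d ih =>
        intro k hk hn hge
        have h3 := neg k (by omega) hge
        have h4 := step k
        have h1 := h.strictMono (show i + k < i + (k + 1) by omega)
        have h5 := ih (k + 1) (by omega) (by omega) (by linarith)
        have := mul_neg_of_pos_of_neg (hl (i + k)) h3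
        linarith
    exact key (n - (k + 2)) k hk (by omega) hge

end IsTurn

/-- Finitely many plane vectors, each with a successor a positive turn away such that the closed
sector between them contains no other vector of the family, form a single cycle under the successor
map, in the order of their arguments. -/
theorem exists_isTurn {ι : Type*} [Finite ι] [Nonempty ι] (w : ι → ℂ) (s : ι → ι)
    (hs : ∀ v, 0 < cross (w v) (w (s v)))
    (hsec : ∀ v u, 0 ≤ cross (w v) (w u) → 0 ≤ cross (w u) (w (s v)) → u = v ∨ u = s v) :
    ∃ (n : ℕ) (e : ℕ → ι) (θ : ℕ → ℝ), IsTurn n (fun i ↦ w (e i)) θ ∧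
      (∀ i, s (e i) = e (i + 1)) ∧ (∀ i, e (i + n) = e i) ∧
      Function.Bijective (fun i : Fin n ↦ e i) := by
  classical
  have := Fintype.ofFinite ι
  -- A vector with the same argument as `w v` would lie in the closed sector starting at `w v`.
  have hinj : Function.Injective (fun v ↦ (w v).arg) := by
    intro v u huv
    have hvu : (w v).arg = (w u).arg := huv
    have h0 : cross (w v) (w u) = 0 := by rw [cross_eq_sin, hvu]; simp
    have h1 : 0 < cross (w u) (w (s v)) := by
      have := hs v
      have hu := norm_pos_of_cross_pos (hs u)
      have hv := norm_pos_of_cross_pos (hs v)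
      rw [cross_eq_sin, ← hvu, mul_assoc]
      rw [cross_eq_sin, mul_assoc, mul_pos_iff_of_pos_left hv] at this
      exact mul_pos hu this
    rcases hsec v u h0.ge h1.le with h | h
    · exact h.symm
    · have := hs v
      rw [← h, h0] at this
      exact absurd this (lt_irrefl _)
  let : LinearOrder ι := LinearOrder.lift' _ hinj
  obtain ⟨n, hn⟩ : ∃ n, Fintype.card ι = n := ⟨_, rfl⟩
  have hn0 : 0 < n := hn ▸ Fintype.card_pos
  let g : Fin n ≃o ι := monoEquivOfFin ι hn
  have hg : ∀ a b : Fin n, a < b → (w (g a)).arg < (w (g b)).arg := fun a b hab ↦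
    g.strictMono hab
  -- The vectors sorted by argument, continued periodically, with arguments lifted to the line.
  let e : ℕ → ι := fun i ↦ g ⟨i % n, Nat.mod_lt _ hn0⟩
  let θ : ℕ → ℝ := fun i ↦ (w (e i)).arg + 2 * Real.pi * (i / n : ℕ)
  have he : ∀ i, e (i + n) = e i := fun i ↦ by simp [e]
  have hθ : ∀ i, θ (i + n) = θ i + 2 * Real.pi := by
    intro i
    simp only [θ, he, Nat.add_div_right _ hn0]
    push_cast
    ring
  have hmono : StrictMono θ := by
    refine strictMono_nat_of_lt_succ fun i ↦ ?_
    rcases Nat.lt_or_ge (i % n + 1) n with h | h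
    · have h1 : (i + 1) % n = i % n + 1 := by
        rw [Nat.add_mod, Nat.mod_eq_of_lt (show 1 < n by omega), Nat.mod_eq_of_lt h]
      have h2 : (i + 1) / n = i / n := by
        rw [Nat.succ_div, if_neg, add_zero]
        intro hd
        rw [Nat.dvd_iff_mod_eq_zero] at hd
        omega
      simp only [θ, h2]
      have : (w (e i)).arg < (w (e (i + 1))).arg := hg _ _ (by simp [Fin.lt_def, h1])
      linarith
    · have h0 : i % n + 1 = n := by have := Nat.mod_lt i hn0; omega
      have h2 : (i + 1) / n = i / n + 1 := by
        rw [Nat.succ_div, if_pos]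
        refine ⟨i / n + 1, ?_⟩
        have := Nat.div_add_mod i n
        rw [mul_add]
        omega
      simp only [θ, h2]
      push_cast
      have h3 := Complex.arg_le_pi (w (e i))
      have h4 := Complex.neg_pi_lt_arg (w (e (i + 1)))
      linarith
  have hcross : ∀ i j, cross (w (e i)) (w (e j)) =
      ‖w (e i)‖ * ‖w (e j)‖ * Real.sin (θ j - θ i) := by
    intro i j
    rw [cross_eq_sin]
    congr 1
    have : θ j - θ i = (w (e j)).arg - (w (e i)).arg + ((j / n : ℕ) : ℤ) * (2 * Real.pi)
        - ((i / n : ℕ) : ℤ) * (2 * Real.pi) := by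
      simp only [θ, Int.cast_natCast]; ring
    rw [this, Real.sin_sub_int_mul_two_pi, Real.sin_add_int_mul_two_pi]
  have hpos : ∀ v, 0 < ‖w v‖ := fun v ↦ norm_pos_of_cross_pos (hs v)
  have hcross' : ∀ i j, 0 ≤ Real.sin (θ j - θ i) → 0 ≤ cross (w (e i)) (w (e j)) := by
    intro i j h
    rw [hcross]
    exact mul_nonneg (mul_nonneg (norm_nonneg _) (norm_nonneg _)) h
  have hsucc : ∀ i, s (e i) = e (i + 1) := by
    intro i
    obtain ⟨j, hij, hji, hj⟩ : ∃ j, i < j ∧ j ≤ i + n ∧ e j = s (e i) := by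
      obtain ⟨a, ha⟩ := g.surjective (s (e i))
      have key : ∀ j, j % n = a → e j = s (e i) := by
        intro j hj
        rw [← ha]
        simp only [e]
        congr 1
        exact Fin.ext hj
      have h1 := Nat.div_add_mod i n
      have h2 := Nat.mod_lt i hn0
      have h3 := a.2
      rcases Nat.lt_or_ge (i % n) a with h | h
      · refine ⟨n * (i / n) + a, by omega, by omega, key _ ?_⟩
        rw [Nat.mul_add_mod, Nat.mod_eq_of_lt h3]
      · refine ⟨n * (i / n) + a + n, by omega, by omega, key _ ?_⟩
        rw [Nat.add_mod_right, Nat.mul_add_mod, Nat.mod_eq_of_lt h3]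
    have h1 : 0 < Real.sin (θ j - θ i) := by
      have := hs (e i)
      rw [← hj, hcross] at this
      exact (mul_pos_iff_of_pos_left (mul_pos (hpos _) (hpos _))).1 this
    have h2 : 0 < θ j - θ i := sub_pos.2 (hmono hij)
    have h3 : θ j - θ i ≤ 2 * Real.pi := by
      have := hmono.monotone hji
      rw [hθ] at this
      linarith
    have h4 : θ j - θ i < Real.pi := by
      by_contra! h
      have : Real.sin (θ j - θ i) ≤ 0 := by
        rw [← Real.sin_sub_two_pi]
        exact Real.sin_nonpos_of_nonpos_of_neg_pi_le (by linarith) (by linarith)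
      linarith
    have h5 := hmono (show i < i + 1 by omega)
    have h6 := hmono.monotone (show i + 1 ≤ j by omega)
    rcases hsec (e i) (e (i + 1))
      (hcross' _ _ (Real.sin_nonneg_of_nonneg_of_le_pi (by linarith) (by linarith)))
      (hj ▸ hcross' _ _ (Real.sin_nonneg_of_nonneg_of_le_pi (by linarith) (by linarith)))
      with h | h
    · have h7 : 0 < cross (w (e i)) (w (e (i + 1))) := by
        rw [hcross]
        exact mul_pos (mul_pos (hpos _) (hpos _))
          (Real.sin_pos_of_pos_of_lt_pi (by linarith) (by linarith))
      rw [h, cross_self] at h7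
      exact absurd h7 (lt_irrefl _)
    · exact h.symm
  refine ⟨n, e, θ, ⟨hmono, hθ, fun i ↦ by rw [he], hcross, fun i ↦ ?_⟩, hsucc, he, ?_⟩
  · rw [← hsucc]
    exact hs _
  · have : (fun i : Fin n ↦ e i) = g := by
      funext i
      simp only [e]
      congr 1
      exact Fin.ext (Nat.mod_eq_of_lt i.2)
    rw [this]
    exact g.bijective

/-! ### Circumcenters -/

lemma circumsphere_spec {s : Finset E3} (hs : s.Nonempty)
    (h : AffineIndependent ℝ ((↑) : s → E3)) :
    (circumcenter s ∈ affineSpan ℝ (s : Set E3) ∧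
      ∀ v ∈ s, dist v (circumcenter s) = circumradius s) ∧
    ∀ (c : E3) (r : ℝ), c ∈ affineSpan ℝ (s : Set E3) → (∀ v ∈ s, dist v c = r) →
      circumcenter s = c := by
  have hne : Nonempty s := hs.to_subtype
  have key : circumsphere s = h.existsUnique_dist_eq.choose := by
    rw [circumsphere, dif_pos ⟨hne, h⟩]
  obtain ⟨⟨h1, h2⟩, h3⟩ := h.existsUnique_dist_eq.choose_spec
  rw [← key] at h1 h2 h3
  have hr : Set.range ((↑) : s → E3) = (s : Set E3) := Subtype.range_coe
  rw [hr] at h1 h2 h3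
  refine ⟨⟨h1, fun v hv ↦ h2 hv⟩, fun c r hc hr ↦ ?_⟩
  have := h3 ⟨c, r⟩ ⟨hc, fun v hv ↦ hr v hv⟩
  rw [circumcenter, ← this]

/-! ### Affine independence and sides of affine subspaces -/

lemma mem_ker_of_mem_affineSpan {W : Type*} [AddCommGroup W] [Module ℝ W] (f : E3 →ₗ[ℝ] W)
    (m : E3) {s : Set E3} (hs : ∀ x ∈ s, f (x - m) = 0) {x : E3} (hx : x ∈ affineSpan ℝ s) :
    f (x - m) = 0 := by
  have h : affineSpan ℝ s ≤ AffineSubspace.mk' m (LinearMap.ker f) := by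
    rw [affineSpan_le]
    intro y hy
    exact AffineSubspace.mem_mk'.2 (hs y hy)
  exact AffineSubspace.mem_mk'.1 (h hx)

/-- If the vectors from points of `A` to `y` and to `x ∉ A` are proportional with factor `t`, then
`x` and `y` lie strictly on the same side of `A` exactly when `t` is positive. -/
lemma sSameSide_iff_of_sub_eq {A : AffineSubspace ℝ E3} {x y a a' : E3} {t : ℝ} (ha : a ∈ A)
    (ha' : a' ∈ A) (hx : x ∉ A) (h : y - a = t • (x - a')) : A.SSameSide y x ↔ 0 < t := by
  have hy : y = t • (x -ᵥ a') +ᵥ a := by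
    rw [vsub_eq_sub, ← h, vadd_eq_add, sub_add_cancel]
  rw [hy]
  constructor
  · intro hs
    by_contra! ht
    exact hs.not_wOppSide (AffineSubspace.wOppSide_smul_vsub_vadd_left x ha' ha ht)
  · intro ht
    exact AffineSubspace.sSameSide_smul_vsub_vadd_left hx ha' ha ht

lemma eq_zero_of_sum_smul_eq_zero {s : Finset E3} (h : AffineIndependent ℝ ((↑) : s → E3))
    (g : E3 → ℝ) (h0 : ∑ v ∈ s, g v = 0) (h1 : ∑ v ∈ s, g v • v = 0) : ∀ v ∈ s, g v = 0 := by
  rw [affineIndependent_iff] at h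
  intro v hv
  have := h s.attach (fun x ↦ g x) (by rw [Finset.sum_attach s g]; exact h0)
    (by rw [← h1, ← Finset.sum_attach s (fun x ↦ g x • x)])
  exact this ⟨v, hv⟩ (Finset.mem_attach _ _)

open Classical in
/-- A face of a simplicial complex whose relative interior meets another face is contained in
it. -/
lemma face_subset_of_sum_mem {K : SimplicialComplex ℝ E3} {s t : Finset E3} (hs : s ∈ K.faces)
    (ht : t ∈ K.faces) (g : E3 → ℝ) (hg : ∀ v ∈ s, 0 < g v) (h1 : ∑ v ∈ s, g v = 1)
    (hx : ∑ v ∈ s, g v • v ∈ convexHull ℝ (t : Set E3)) : s ⊆ t := by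
  have hxs : ∑ v ∈ s, g v • v ∈ convexHull ℝ (s : Set E3) :=
    Finset.mem_convexHull'.2 ⟨g, fun v hv ↦ (hg v hv).le, h1, rfl⟩
  have hst := K.inter_subset_convexHull hs ht ⟨hxs, hx⟩
  rw [← Finset.coe_inter] at hst
  obtain ⟨f, -, hf1, hf⟩ := Finset.mem_convexHull'.1 hst
  intro v hv
  by_contra hvt
  let f' : E3 → ℝ := fun v ↦ if v ∈ t then f v else 0
  have e1 : ∑ v ∈ s, f' v = 1 := by
    rw [← hf1, ← Finset.filter_mem_eq_inter, Finset.sum_filter]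
  have e2 : ∑ v ∈ s, f' v • v = ∑ v ∈ s, g v • v := by
    rw [← hf, ← Finset.filter_mem_eq_inter, Finset.sum_filter]
    refine Finset.sum_congr rfl fun v _ ↦ ?_
    simp only [f', ite_smul, zero_smul]
  have := eq_zero_of_sum_smul_eq_zero (K.indep hs) (fun v ↦ g v - f' v)
    (by rw [Finset.sum_sub_distrib, h1, e1, sub_self])
    (by simp only [sub_smul, Finset.sum_sub_distrib, e2, sub_self]) v hv
  simp only [f', if_neg hvt, sub_zero] at this
  exact (hg v hv).ne' this

/-! ### Coordinates around an edge -/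

/-- An isometric identification of the plane perpendicular to the edge `pq` with the complex plane:
`toPlane` is the orthogonal projection along the edge, and `ofPlane` the inclusion of the plane. -/
structure EdgeFrame (p q : E3) where
  toPlane : E3 →ₗ[ℝ] ℂ
  ofPlane : ℂ →ₗ[ℝ] E3
  toPlane_ofPlane : ∀ z, toPlane (ofPlane z) = z
  toPlane_axis : toPlane (q - p) = 0
  exists_eq : ∀ x, ∃ t : ℝ, x = ofPlane (toPlane x) + t • (q - p)
  inner_ofPlane : ∀ z x, inner ℝ (ofPlane z) x = dot z (toPlane x)

lemma exists_edgeFrame {p q : E3} (hpq : p ≠ q) : Nonempty (EdgeFrame p q) := by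
  have hu : q - p ≠ 0 := sub_ne_zero.2 hpq.symm
  have : Fact (Module.finrank ℝ E3 = 2 + 1) := ⟨by simp [E3]⟩
  have hrank : Module.finrank ℝ (ℝ ∙ (q - p))ᗮ = 2 :=
    Submodule.finrank_orthogonal_span_singleton hu
  let b := (stdOrthonormalBasis ℝ (ℝ ∙ (q - p))ᗮ).reindex (finCongr hrank)
  let L : E3 →ₗ[ℝ] ℂ :=
    { toFun := fun x ↦ ⟨inner ℝ (b 0 : E3) x, inner ℝ (b 1 : E3) x⟩
      map_add' := fun x y ↦ by apply Complex.ext <;> simp [inner_add_right]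
      map_smul' := fun r x ↦ by apply Complex.ext <;> simp [inner_smul_right] }
  let M : ℂ →ₗ[ℝ] E3 :=
    { toFun := fun z ↦ z.re • (b 0 : E3) + z.im • (b 1 : E3)
      map_add' := fun x y ↦ by simp [add_smul]; abel
      map_smul' := fun r x ↦ by simp [mul_smul] }
  refine ⟨L, M, ?_, ?_, ?_, ?_⟩
  · have h : ∀ i j, inner ℝ (b i : E3) (b j : E3) = if i = j then 1 else 0 := fun i j ↦ by
      rw [← Submodule.coe_inner]
      exact orthonormal_iff_ite.1 b.orthonormal i j
    intro z
    apply Complex.ext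
    · change inner ℝ (b 0 : E3) (z.re • (b 0 : E3) + z.im • (b 1 : E3)) = _
      rw [inner_add_right, inner_smul_right, inner_smul_right, h, h]
      simp
    · change inner ℝ (b 1 : E3) (z.re • (b 0 : E3) + z.im • (b 1 : E3)) = _
      rw [inner_add_right, inner_smul_right, inner_smul_right, h, h]
      simp
  · have h : ∀ i, inner ℝ (b i : E3) (q - p) = 0 := fun i ↦
      (Submodule.mem_orthogonal' _ _).1 (b i).2 _ (Submodule.mem_span_singleton_self _)
    apply Complex.ext
    · exact h 0
    · exact h 1
  · intro x
    obtain ⟨t, ht⟩ := Submodule.mem_span_singleton.1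
      ((ℝ ∙ (q - p)).starProjection_apply_mem x)
    refine ⟨t, ?_⟩
    have h1 := b.sum_repr' ((ℝ ∙ (q - p))ᗮ.orthogonalProjectionOnto x)
    rw [Fin.sum_univ_two] at h1
    have h2 := congrArg (Subtype.val) h1
    simp only [Submodule.coe_add, Submodule.coe_smul, Submodule.coe_inner] at h2
    have h3 : ∀ i, inner ℝ (b i : E3) ((ℝ ∙ (q - p))ᗮ.orthogonalProjectionOnto x : E3) =
        inner ℝ (b i : E3) x := fun i ↦ by
      rw [← Submodule.coe_inner, ← Submodule.inner_orthogonalProjectionOnto_eq_of_mem_left (b i) x]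
    rw [h3, h3] at h2
    change x = (inner ℝ (b 0 : E3) x • (b 0 : E3) + inner ℝ (b 1 : E3) x • (b 1 : E3)) + _
    rw [h2, ht, add_comm]
    exact ((ℝ ∙ (q - p)).starProjection_add_starProjection_orthogonal x).symm
  · intro z x
    change inner ℝ (z.re • (b 0 : E3) + z.im • (b 1 : E3)) x = _
    simp [inner_add_left, inner_smul_left, dot, L]

namespace EdgeFrame

variable {p q : E3} (F : EdgeFrame p q)

/-- The plane coordinates of a point, with the midpoint of the edge as the origin. -/
noncomputable def vec (x : E3) : ℂ := F.toPlane (x - midpoint ℝ p q)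

/-- Half the power of `x` with respect to the sphere with diameter `pq`. A point `z` of the
perpendicular bisector of `pq` is as far from `x` as from `p` exactly when `dot z (vec x)` is
this number. -/
noncomputable def level (_ : EdgeFrame p q) (x : E3) : ℝ :=
  (‖x - midpoint ℝ p q‖ ^ 2 - ‖p - midpoint ℝ p q‖ ^ 2) / 2

lemma left_sub : p - midpoint ℝ p q = (-(1 / 2) : ℝ) • (q - p) := by
  rw [midpoint_eq_smul_add, invOf_eq_inv]
  module

lemma right_sub : q - midpoint ℝ p q = (1 / 2 : ℝ) • (q - p) := by
  rw [midpoint_eq_smul_add, invOf_eq_inv]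
  module

lemma vec_left : F.vec p = 0 := by rw [vec, left_sub, map_smul, F.toPlane_axis, smul_zero]

lemma vec_right : F.vec q = 0 := by rw [vec, right_sub, map_smul, F.toPlane_axis, smul_zero]

lemma eq_add_ofPlane_vec (hpq : p ≠ q) {c : E3} (h : dist p c = dist q c) :
    c = midpoint ℝ p q + F.ofPlane (F.vec c) := by
  obtain ⟨t, ht⟩ := F.exists_eq (c - midpoint ℝ p q)
  have h1 : inner ℝ (c - midpoint ℝ p q) (q - p) = 0 := by
    rw [dist_eq_norm, dist_eq_norm, ← sq_eq_sq₀ (norm_nonneg _) (norm_nonneg _)] at h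
    have e1 : p - c = (p - midpoint ℝ p q) - (c - midpoint ℝ p q) := by abel
    have e2 : q - c = (q - midpoint ℝ p q) - (c - midpoint ℝ p q) := by abel
    rw [e1, e2, norm_sub_sq_real (p - _), norm_sub_sq_real (q - _), left_sub, right_sub,
      inner_smul_left, inner_smul_left, norm_smul, norm_smul,
      real_inner_comm (c - midpoint ℝ p q)] at h
    simp at h
    linarith
  have h2 : t = 0 := by
    rw [ht, inner_add_left, F.inner_ofPlane, F.toPlane_axis, inner_smul_left] at h1
    have : inner ℝ (q - p) (q - p) ≠ 0 := by
      rw [inner_self_ne_zero]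
      exact sub_ne_zero.2 hpq.symm
    simpa [dot, this, sub_eq_zero, hpq.symm] using h1
  rw [h2, zero_smul, add_zero] at ht
  rw [vec, ← ht]
  abel

lemma dist_sq (z : ℂ) (x : E3) : dist x (midpoint ℝ p q + F.ofPlane z) ^ 2 =
    dist p (midpoint ℝ p q + F.ofPlane z) ^ 2 + 2 * (F.level x - dot z (F.vec x)) := by
  have h : ∀ y, dist y (midpoint ℝ p q + F.ofPlane z) ^ 2 =
      ‖y - midpoint ℝ p q‖ ^ 2 - 2 * dot z (F.vec y) + ‖F.ofPlane z‖ ^ 2 := by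
    intro y
    rw [dist_eq_norm, ← sub_sub, norm_sub_sq_real, real_inner_comm, F.inner_ofPlane, vec]
  rw [h, h, vec_left, level]
  simp only [dot, Complex.zero_re, Complex.zero_im]
  ring

end EdgeFrame

/-! ### The triangles and tetrahedra around an edge -/

section Link

open Classical

variable {K : SimplicialComplex ℝ E3} {p q : E3}

/-- `v` is the vertex opposite to the edge `pq` of a triangle of `K`. -/
structure IsSpoke (K : SimplicialComplex ℝ E3) (p q v : E3) : Prop where
  ne_left : v ≠ p
  ne_right : v ≠ q
  mem_faces : {v, p, q} ∈ K.faces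

/-- `vy` is the edge opposite to the edge `pq` of a tetrahedron of `K`. -/
structure IsSector (K : SimplicialComplex ℝ E3) (p q v y : E3) : Prop where
  ne : v ≠ y
  left_ne_left : v ≠ p
  left_ne_right : v ≠ q
  right_ne_left : y ≠ p
  right_ne_right : y ≠ q
  mem_faces : {v, y, p, q} ∈ K.faces

namespace IsSector

variable {v y y' u : E3}

lemma symm (h : IsSector K p q v y) : IsSector K p q y v :=
  ⟨h.ne.symm, h.right_ne_left, h.right_ne_right, h.left_ne_left, h.left_ne_right, by
    rw [Finset.insert_comm]; exact h.mem_faces⟩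

lemma isSpoke (h : IsSector K p q v y) : IsSpoke K p q v :=
  ⟨h.left_ne_left, h.left_ne_right, K.down_closed h.mem_faces
    (Finset.insert_subset_insert _ (Finset.subset_insert _ _)) (Finset.insert_nonempty _ _)⟩

lemma sum_eq (h : IsSector K p q v y) (hpq : p ≠ q) {W : Type*} [AddCommMonoid W] (g : E3 → W) :
    ∑ x ∈ {v, y, p, q}, g x = g v + (g y + (g p + g q)) := by
  rw [Finset.sum_insert, Finset.sum_insert, Finset.sum_pair hpq]
  · simp [h.right_ne_left, h.right_ne_right]
  · simp [h.left_ne_left, h.left_ne_right, h.ne]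

/-- A linear relation between the projections of `v` and `y` would be an affine relation between the
vertices of the tetrahedron. -/
lemma cross_ne_zero (h : IsSector K p q v y) (hpq : p ≠ q) (F : EdgeFrame p q) :
    cross (F.vec v) (F.vec y) ≠ 0 := by
  intro h0
  obtain ⟨a, b, hab, hz⟩ : ∃ a b : ℝ, (a ≠ 0 ∨ b ≠ 0) ∧ a • F.vec v + b • F.vec y = 0 := by
    by_cases hv : F.vec v = 0
    · exact ⟨1, 0, by simp, by simp [hv]⟩
    · refine ⟨dot (F.vec v) (F.vec y), -dot (F.vec v) (F.vec v),
        Or.inr (neg_ne_zero.2 (dot_self_pos hv).ne'), ?_⟩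
      simp only [cross] at h0
      apply Complex.ext
      · simp only [dot, Complex.add_re, Complex.real_smul, Complex.mul_re, Complex.ofReal_re,
          Complex.ofReal_im, Complex.zero_re]
        linear_combination (F.vec v).im * h0
      · simp only [dot, Complex.add_im, Complex.real_smul, Complex.mul_im, Complex.ofReal_re,
          Complex.ofReal_im, Complex.zero_im]
        linear_combination -(F.vec v).re * h0
  obtain ⟨t, ht⟩ := F.exists_eq (a • (v - midpoint ℝ p q) + b • (y - midpoint ℝ p q))
  rw [map_add, map_smul, map_smul] at ht
  change _ = F.ofPlane (a • F.vec v + b • F.vec y) + _ at ht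
  rw [hz, map_zero, zero_add, midpoint_eq_smul_add, invOf_eq_inv] at ht
  -- The relation `a v + b y ∈ span (q - p)`, relative to the midpoint, in barycentric form.
  let g : E3 → ℝ := fun x ↦ if x = v then a else if x = y then b else if x = p then
    t - (a + b) / 2 else - t - (a + b) / 2
  have gv : g v = a := by simp [g]
  have gy : g y = b := by simp [g, h.ne.symm]
  have gp : g p = t - (a + b) / 2 := by simp [g, h.left_ne_left.symm, h.right_ne_left.symm]
  have gq : g q = -t - (a + b) / 2 := by
    simp [g, h.left_ne_right.symm, h.right_ne_right.symm, hpq.symm]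
  have key := eq_zero_of_sum_smul_eq_zero (K.indep h.mem_faces) g
    (by rw [h.sum_eq hpq, gv, gy, gp, gq]; ring)
    (by rw [h.sum_eq hpq, gv, gy, gp, gq]; refine Eq.trans ?_ (sub_eq_zero.2 ht); module)
  have ha := key v (by simp)
  have hb := key y (by simp)
  rw [gv] at ha
  rw [gy] at hb
  simp [ha, hb] at hab

/-- The closed sector spanned by a tetrahedron around `pq` meets no triangle of `K` containing `pq`
other than its two sides. -/
lemma eq_or_eq (h : IsSector K p q v y) (hpq : p ≠ q) (F : EdgeFrame p q)
    (hu : IsSpoke K p q u) (hpos : 0 < cross (F.vec v) (F.vec y))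
    (h1 : 0 ≤ cross (F.vec v) (F.vec u)) (h2 : 0 ≤ cross (F.vec u) (F.vec y)) :
    u = v ∨ u = y := by
  obtain ⟨a, b, ha, hb, hz⟩ : ∃ a b : ℝ, 0 ≤ a ∧ 0 ≤ b ∧
      F.vec u = a • F.vec v + b • F.vec y := by
    refine ⟨_, _, div_nonneg h2 hpos.le, div_nonneg h1 hpos.le, ?_⟩
    have := hpos.ne'
    apply Complex.ext
    · simp only [Complex.add_re, Complex.real_smul, Complex.mul_re, Complex.ofReal_re,
          Complex.ofReal_im]
      field_simp
      simp only [cross]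
      ring
    · simp only [Complex.add_im, Complex.real_smul, Complex.mul_im, Complex.ofReal_re,
          Complex.ofReal_im]
      field_simp
      simp only [cross]
      ring
  obtain ⟨t, ht⟩ := F.exists_eq ((u - midpoint ℝ p q) -
    (a • (v - midpoint ℝ p q) + b • (y - midpoint ℝ p q)))
  rw [map_sub, map_add, map_smul, map_smul] at ht
  change _ = F.ofPlane (F.vec u - (a • F.vec v + b • F.vec y)) + _ at ht
  rw [← hz, sub_self, map_zero, zero_add, midpoint_eq_smul_add, invOf_eq_inv] at ht
  -- A point of the triangle close enough to the midpoint of `pq` has nonnegative barycentric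
  -- coordinates in the tetrahedron, despite its component along the edge.
  let ε : ℝ := 1 / (2 + a + b + 2 * |t|)
  have hden : 0 < 2 + a + b + 2 * |t| := by positivity
  have hε : 0 < ε := by positivity
  have hεd : ε * (2 + a + b + 2 * |t|) = 1 := by simp only [ε]; field_simp
  have hab : 0 ≤ ε * (a + b) := by positivity
  have ht0 : 0 ≤ ε * |t| := by positivity
  have ht1 : ε * t ≤ ε * |t| := mul_le_mul_of_nonneg_left (le_abs_self t) hε.le
  have ht2 : -(ε * |t|) ≤ ε * t := by
    have := mul_le_mul_of_nonneg_left (neg_abs_le t) hε.le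
    linarith
  let g : E3 → ℝ := fun x ↦ if x = u then ε else (1 - ε) / 2
  have gu : g u = ε := by simp [g]
  have gp : g p = (1 - ε) / 2 := by simp [g, hu.ne_left.symm]
  have gq : g q = (1 - ε) / 2 := by simp [g, hu.ne_right.symm]
  have hsum : ∀ {W : Type} [AddCommMonoid W] (f : E3 → W),
      ∑ x ∈ {u, p, q}, f x = f u + (f p + f q) := by
    intro W _ f
    rw [Finset.sum_insert (by simp [hu.ne_left, hu.ne_right]), Finset.sum_pair hpq]
  have hsub : ({u, p, q} : Finset E3) ⊆ {v, y, p, q} := by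
    refine face_subset_of_sum_mem hu.mem_faces h.mem_faces g ?_ ?_ ?_
    · intro x hx
      simp only [Finset.mem_insert, Finset.mem_singleton] at hx
      rcases hx with rfl | rfl | rfl
      · rw [gu]; exact hε
      · rw [gp]; linarith
      · rw [gq]; linarith
    · rw [hsum, gu, gp, gq]; ring
    · rw [hsum, gu, gp, gq]
      -- The same point in terms of the vertices of the tetrahedron.
      let f : E3 → ℝ := fun x ↦ if x = v then ε * a else if x = y then ε * b else if x = p then
        (1 - ε * (a + b)) / 2 - ε * t else (1 - ε * (a + b)) / 2 + ε * t
      have fv : f v = ε * a := by simp [f]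
      have fy : f y = ε * b := by simp [f, h.ne.symm]
      have fp : f p = (1 - ε * (a + b)) / 2 - ε * t := by
        simp [f, h.left_ne_left.symm, h.right_ne_left.symm]
      have fq : f q = (1 - ε * (a + b)) / 2 + ε * t := by
        simp [f, h.left_ne_right.symm, h.right_ne_right.symm, hpq.symm]
      refine Finset.mem_convexHull'.2 ⟨f, ?_, ?_, ?_⟩
      · intro x hx
        simp only [Finset.mem_insert, Finset.mem_singleton] at hx
        rcases hx with rfl | rfl | rfl | rfl
        · rw [fv]; positivity
        · rw [fy]; positivity
        · rw [fp]; linarith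
        · rw [fq]; linarith
      · rw [h.sum_eq hpq, fv, fy, fp, fq]; ring
      · rw [h.sum_eq hpq, fv, fy, fp, fq]
        refine sub_eq_zero.1 (Eq.trans ?_ (smul_eq_zero_of_right (-ε) (sub_eq_zero.2 ht)))
        module
  have := hsub (Finset.mem_insert_self _ _)
  simpa [hu.ne_left, hu.ne_right] using this

/-- Two tetrahedra on the same side of a common triangle coincide. -/
lemma eq_of_cross_pos (h : IsSector K p q v y) (h' : IsSector K p q v y') (hpq : p ≠ q)
    (F : EdgeFrame p q) (hy : 0 < cross (F.vec v) (F.vec y))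
    (hy' : 0 < cross (F.vec v) (F.vec y')) : y = y' := by
  rcases le_total 0 (cross (F.vec y) (F.vec y')) with hc | hc
  · exact (h'.eq_or_eq hpq F h.symm.isSpoke hy' hy.le hc).resolve_left h.ne.symm
  · rw [cross_swap] at hc
    exact ((h.eq_or_eq hpq F h'.symm.isSpoke hy hy'.le (by linarith)).resolve_left h'.ne.symm).symm

lemma eq_of_cross_neg (h : IsSector K p q v y) (h' : IsSector K p q v y') (hpq : p ≠ q)
    (F : EdgeFrame p q) (hy : cross (F.vec v) (F.vec y) < 0)
    (hy' : cross (F.vec v) (F.vec y') < 0) : y = y' := by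
  rw [cross_swap, neg_lt_zero] at hy hy'
  rcases le_total 0 (cross (F.vec y) (F.vec y')) with hc | hc
  · exact ((h.symm.eq_or_eq hpq F h'.symm.isSpoke hy hc hy'.le).resolve_right h'.ne.symm).symm
  · rw [cross_swap] at hc
    exact (h'.symm.eq_or_eq hpq F h.symm.isSpoke hy' (by linarith) hy.le).resolve_right h.ne.symm

end IsSector

lemma IsSpoke.mem_incident {v : E3} (h : IsSpoke K p q v) (hpq : p ≠ q) :
    {v, p, q} ∈ incident K {p, q} 3 :=
  ⟨h.mem_faces, Finset.subset_insert _ _, by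
    rw [Finset.card_insert_of_notMem (by simp [h.ne_left, h.ne_right]), Finset.card_pair hpq]⟩

lemma exists_isSpoke_of_mem_incident (hpq : p ≠ q) {σ : Finset E3}
    (hσ : σ ∈ incident K {p, q} 3) : ∃ v, IsSpoke K p q v ∧ σ = {v, p, q} := by
  obtain ⟨h1, h2, h3⟩ := hσ
  obtain ⟨v, hv, rfl⟩ := (Finset.covBy_iff_exists_insert (s := {p, q}) (t := σ)).1
    (Finset.covBy_iff_card_sdiff_eq_one.2 ⟨h2, by
      rw [Finset.card_sdiff_of_subset h2, Finset.card_pair hpq, h3]⟩)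
  simp only [Finset.mem_insert, Finset.mem_singleton, not_or] at hv
  exact ⟨v, ⟨hv.1, hv.2, h1⟩, rfl⟩

lemma IsSector.card_eq {v y : E3} (h : IsSector K p q v y) (hpq : p ≠ q) :
    ({v, y, p, q} : Finset E3).card = 4 := by
  rw [Finset.card_insert_of_notMem (by simp [h.ne, h.left_ne_left, h.left_ne_right]),
    Finset.card_insert_of_notMem (by simp [h.right_ne_left, h.right_ne_right]),
    Finset.card_pair hpq]

lemma IsSector.mem_incident {v y : E3} (h : IsSector K p q v y) (hpq : p ≠ q) :
    {v, y, p, q} ∈ incident K {v, p, q} 4 :=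
  ⟨h.mem_faces, Finset.insert_subset_insert _ (Finset.subset_insert _ _), h.card_eq hpq⟩

lemma IsSpoke.exists_isSector_of_mem_incident {v : E3} (h : IsSpoke K p q v) (hpq : p ≠ q)
    {ρ : Finset E3} (hρ : ρ ∈ incident K {v, p, q} 4) :
    ∃ y, IsSector K p q v y ∧ ρ = {v, y, p, q} := by
  obtain ⟨h1, h2, h3⟩ := hρ
  obtain ⟨y, hy, rfl⟩ := (Finset.covBy_iff_exists_insert (s := {v, p, q}) (t := ρ)).1
    (Finset.covBy_iff_card_sdiff_eq_one.2 ⟨h2, by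
      rw [Finset.card_sdiff_of_subset h2, (h.mem_incident hpq).2.2, h3]⟩)
  simp only [Finset.mem_insert, Finset.mem_singleton, not_or] at hy
  rw [Finset.insert_comm] at h1
  exact ⟨y, ⟨Ne.symm hy.1, h.ne_left, h.ne_right, hy.2.1, hy.2.2, h1⟩, Finset.insert_comm _ _ _⟩

lemma exists_isSector_of_mem_incident (hpq : p ≠ q) {ρ : Finset E3}
    (hρ : ρ ∈ incident K {p, q} 4) : ∃ v y, IsSector K p q v y ∧ ρ = {v, y, p, q} := by
  obtain ⟨h1, h2, h3⟩ := hρ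
  obtain ⟨v, hv⟩ : (ρ \ {p, q}).Nonempty := by
    rw [← Finset.card_pos, Finset.card_sdiff_of_subset h2, Finset.card_pair hpq, h3]
    norm_num
  simp only [Finset.mem_sdiff, Finset.mem_insert, Finset.mem_singleton, not_or] at hv
  have hsub : {v, p, q} ⊆ ρ := Finset.insert_subset hv.1 h2
  have hv' : IsSpoke K p q v :=
    ⟨hv.2.1, hv.2.2, K.down_closed h1 hsub (Finset.insert_nonempty _ _)⟩
  exact ⟨v, hv'.exists_isSector_of_mem_incident hpq ⟨h1, hsub, h3⟩⟩

/-- At an internal edge there is a tetrahedron on either side of each triangle. -/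
lemma IsSpoke.exists_isSector {v : E3} (h : IsSpoke K p q v) (hpq : p ≠ q) (F : EdgeFrame p q)
    (hint : IsInternal K {p, q}) :
    (∃ y, IsSector K p q v y ∧ 0 < cross (F.vec v) (F.vec y)) ∧
    ∃ y, IsSector K p q v y ∧ cross (F.vec v) (F.vec y) < 0 := by
  obtain ⟨ρ, hρ, ρ', hρ', hne⟩ := hint _ (h.mem_incident hpq)
  obtain ⟨y, hy, rfl⟩ := h.exists_isSector_of_mem_incident hpq hρ
  obtain ⟨y', hy', rfl⟩ := h.exists_isSector_of_mem_incident hpq hρ'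
  have hyy : y ≠ y' := by rintro rfl; exact hne rfl
  rcases (hy.cross_ne_zero hpq F).lt_or_gt with h1 | h1 <;>
  rcases (hy'.cross_ne_zero hpq F).lt_or_gt with h2 | h2
  · exact absurd (hy.eq_of_cross_neg hy' hpq F h1 h2) hyy
  · exact ⟨⟨y', hy', h2⟩, y, hy, h1⟩
  · exact ⟨⟨y, hy, h1⟩, y', hy', h2⟩
  · exact absurd (hy.eq_of_cross_pos hy' hpq F h1 h2) hyy

end Link

/-! ### Circumcenters and signed areas around an edge -/

section Centers

open Classical

variable {K : SimplicialComplex ℝ E3} {p q v y x : E3}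

lemma IsSpoke.pair_mem_faces (h : IsSpoke K p q v) : {p, q} ∈ K.faces :=
  K.down_closed h.mem_faces (Finset.subset_insert _ _) (Finset.insert_nonempty _ _)

lemma circumcenter_pair (h : {p, q} ∈ K.faces) : circumcenter {p, q} = midpoint ℝ p q := by
  refine (circumsphere_spec (Finset.insert_nonempty _ _) (K.indep h)).2 _ (dist p q / 2) ?_ ?_
  · rw [Finset.coe_pair]
    exact AffineMap.lineMap_mem_affineSpan_pair _ _ _
  · intro x hx
    simp only [Finset.mem_insert, Finset.mem_singleton] at hx
    rcases hx with rfl | rfl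
    · rw [dist_left_midpoint]; simp; ring
    · rw [dist_right_midpoint]; simp; ring

namespace EdgeFrame

variable (F : EdgeFrame p q)

lemma dist_right_eq (z : ℂ) : dist q (midpoint ℝ p q + F.ofPlane z) =
    dist p (midpoint ℝ p q + F.ofPlane z) := by
  rw [← sq_eq_sq₀ dist_nonneg dist_nonneg, F.dist_sq, F.vec_right, level, left_sub, right_sub,
    norm_smul, norm_smul]
  simp [dot]

lemma dist_eq_iff (z : ℂ) : dist x (midpoint ℝ p q + F.ofPlane z) =
    dist p (midpoint ℝ p q + F.ofPlane z) ↔ dot z (F.vec x) = F.level x := by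
  rw [← sq_eq_sq₀ dist_nonneg dist_nonneg, F.dist_sq z x]
  constructor <;> intro h <;> linarith

lemma dist_lt_iff (z : ℂ) : dist p (midpoint ℝ p q + F.ofPlane z) <
    dist x (midpoint ℝ p q + F.ofPlane z) ↔ dot z (F.vec x) < F.level x := by
  rw [← sq_lt_sq₀ dist_nonneg dist_nonneg, F.dist_sq z x]
  constructor <;> intro h <;> linarith

lemma dist_add_ofPlane (m : E3) (z w : ℂ) :
    dist (m + F.ofPlane z) (m + F.ofPlane w) = ‖z - w‖ := by
  rw [dist_add_left, dist_eq_norm, ← map_sub, ← sq_eq_sq₀ (norm_nonneg _) (norm_nonneg _),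
    ← real_inner_self_eq_norm_sq, F.inner_ofPlane, F.toPlane_ofPlane, ← Complex.normSq_eq_norm_sq,
    Complex.normSq_apply, dot]

end EdgeFrame

/-- The circumcenter of a tetrahedron at `pq` lies in the perpendicular bisector of `pq`, where it
is the intersection of the lines belonging to `v` and `y`; being outside the circumsphere is a linear
inequality. -/
lemma IsSector.circumcenter_spec (h : IsSector K p q v y) (hpq : p ≠ q) (F : EdgeFrame p q) :
    circumcenter {v, y, p, q} =
        midpoint ℝ p q + F.ofPlane (F.vec (circumcenter {v, y, p, q})) ∧
      dot (F.vec (circumcenter {v, y, p, q})) (F.vec v) = F.level v ∧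
      dot (F.vec (circumcenter {v, y, p, q})) (F.vec y) = F.level y ∧
      ∀ x, circumradius {v, y, p, q} < dist x (circumcenter {v, y, p, q}) ↔
        dot (F.vec (circumcenter {v, y, p, q})) (F.vec x) < F.level x := by
  obtain ⟨⟨-, hd⟩, -⟩ := circumsphere_spec (Finset.insert_nonempty _ _) (K.indep h.mem_faces)
  have hp := hd p (by simp)
  have hc := F.eq_add_ofPlane_vec hpq (hp.trans (hd q (by simp)).symm)
  have hv := (hd v (by simp)).trans hp.symm
  have hy := (hd y (by simp)).trans hp.symm
  refine ⟨hc, ?_, ?_, fun x ↦ ?_⟩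
  · rw [hc] at hv
    exact (F.dist_eq_iff _).1 hv
  · rw [hc] at hy
    exact (F.dist_eq_iff _).1 hy
  · rw [← hp, ← F.dist_lt_iff, ← hc]

lemma midpoint_mem_affineSpan {s : Set E3} (hp : p ∈ s) (hq : q ∈ s) :
    midpoint ℝ p q ∈ affineSpan ℝ s :=
  AffineMap.lineMap_mem _ (mem_affineSpan ℝ hp) (mem_affineSpan ℝ hq)

lemma add_smul_mem_affineSpan {s : Set E3} {c : E3} (hp : p ∈ s) (hq : q ∈ s)
    (hc : c ∈ affineSpan ℝ s) (t : ℝ) : c + t • (q - p) ∈ affineSpan ℝ s := by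
  have := AffineSubspace.vadd_mem_of_mem_direction ((affineSpan ℝ s).direction.smul_mem t
    (AffineSubspace.vsub_mem_direction (mem_affineSpan ℝ hq) (mem_affineSpan ℝ hp))) hc
  rwa [vsub_eq_sub, vadd_eq_add, add_comm] at this

lemma add_smul_sub_midpoint_mem_affineSpan {s : Set E3} {c : E3} (hp : p ∈ s) (hq : q ∈ s)
    (hv : v ∈ s) (hc : c ∈ affineSpan ℝ s) (t : ℝ) :
    c + t • (v - midpoint ℝ p q) ∈ affineSpan ℝ s := by
  have := AffineSubspace.vadd_mem_of_mem_direction ((affineSpan ℝ s).direction.smul_mem t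
    (AffineSubspace.vsub_mem_direction (mem_affineSpan ℝ hv) (midpoint_mem_affineSpan hp hq))) hc
  rwa [vsub_eq_sub, vadd_eq_add, add_comm] at this

/-- The circumcenter of a triangle at `pq` is the foot of the perpendicular from the midpoint of
`pq` to the line of points of the perpendicular plane equidistant from `p` and `v`. -/
lemma IsSpoke.circumcenter_eq (h : IsSpoke K p q v) (F : EdgeFrame p q) (hv : F.vec v ≠ 0) :
    circumcenter {v, p, q} = midpoint ℝ p q +
      F.ofPlane ((F.level v / dot (F.vec v) (F.vec v)) • F.vec v) := by
  have hd := (dot_self_pos hv).ne'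
  refine (circumsphere_spec (Finset.insert_nonempty _ _) (K.indep h.mem_faces)).2 _
    (dist p (midpoint ℝ p q +
      F.ofPlane ((F.level v / dot (F.vec v) (F.vec v)) • F.vec v))) ?_ ?_
  · obtain ⟨t, ht⟩ := F.exists_eq (v - midpoint ℝ p q)
    have e : F.ofPlane (F.vec v) = v - midpoint ℝ p q + (-t) • (q - p) := by
      rw [neg_smul, ← sub_eq_add_neg, eq_sub_iff_add_eq]
      exact ht.symm
    rw [map_smul, e, smul_add, smul_smul, ← add_assoc]
    exact add_smul_mem_affineSpan (by simp) (by simp) (add_smul_sub_midpoint_mem_affineSpan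
      (by simp) (by simp) (by simp) (midpoint_mem_affineSpan (by simp) (by simp)) _) _
  · intro x hx
    simp only [Finset.mem_insert, Finset.mem_singleton] at hx
    rcases hx with rfl | rfl | rfl
    · rw [F.dist_eq_iff]
      have : ∀ (r : ℝ) (z : ℂ), dot (r • z) z = r * dot z z := by
        intro r z
        simp [dot]
        ring
      rw [this, div_mul_cancel₀ _ hd]
    · rfl
    · exact F.dist_right_eq _

lemma IsSpoke.stepSign_eq (h : IsSpoke K p q v) (F : EdgeFrame p q) (hv : F.vec v ≠ 0) :
    stepSign {p, q} {v, p, q} = if 0 < F.level v then 1 else -1 := by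
  have hd := dot_self_pos hv
  have hnot : v ∉ affineSpan ℝ (({p, q} : Finset E3) : Set E3) := by
    intro hm
    refine hv (mem_ker_of_mem_affineSpan F.toPlane (midpoint ℝ p q) ?_ hm)
    intro x hx
    simp only [Finset.coe_pair, Set.mem_insert_iff, Set.mem_singleton_iff] at hx
    rcases hx with rfl | rfl
    · exact F.vec_left
    · exact F.vec_right
  have hiff : (affineSpan ℝ (({p, q} : Finset E3) : Set E3)).SSameSide
      (circumcenter {v, p, q}) v ↔ 0 < F.level v := by
    obtain ⟨t, ht⟩ := F.exists_eq (v - midpoint ℝ p q)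
    have hm : midpoint ℝ p q ∈ affineSpan ℝ (({p, q} : Finset E3) : Set E3) :=
      midpoint_mem_affineSpan (by simp) (by simp)
    rw [sSameSide_iff_of_sub_eq hm
      (add_smul_mem_affineSpan (p := p) (q := q) (by simp) (by simp) hm t) hnot
      (t := F.level v / dot (F.vec v) (F.vec v)), div_pos_iff_of_pos_right hd]
    rw [h.circumcenter_eq F hv, map_smul, add_sub_cancel_left]
    congr 1
    rw [← sub_sub, eq_sub_iff_add_eq]
    exact ht.symm
  rw [stepSign]
  refine if_congr ?_ rfl rfl
  rw [← hiff]
  constructor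
  · intro H
    exact H v (by simp) (by simp [h.ne_left, h.ne_right])
  · intro H x hx hx'
    rw [Finset.mem_insert] at hx
    rcases hx with rfl | hx
    · exact H
    · exact absurd hx hx'

lemma IsSector.stepSign_eq (h : IsSector K p q v y) (hpq : p ≠ q) (F : EdgeFrame p q) {C : ℂ}
    (hC : circumcenter {v, y, p, q} = midpoint ℝ p q + F.ofPlane C) :
    stepSign {v, p, q} {v, y, p, q} =
      if 0 < cross (F.vec v) C / cross (F.vec v) (F.vec y) then 1 else -1 := by
  have hcr := h.cross_ne_zero hpq F
  have hv : F.vec v ≠ 0 := by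
    intro h0
    simp [h0, cross] at hcr
  let A := affineSpan ℝ (({v, p, q} : Finset E3) : Set E3)
  have hnot : y ∉ A := by
    intro hm
    let f : E3 →ₗ[ℝ] ℝ :=
      { toFun := fun x ↦ cross (F.vec v) (F.toPlane x)
        map_add' := fun a b ↦ by simp only [cross, map_add, Complex.add_re, Complex.add_im]; ring
        map_smul' := fun a b ↦ by simp [cross]; ring }
    refine hcr (mem_ker_of_mem_affineSpan f (midpoint ℝ p q) ?_ hm)
    intro x hx
    change cross (F.vec v) (F.vec x) = 0
    simp only [Finset.coe_insert, Finset.coe_singleton, Set.mem_insert_iff,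
      Set.mem_singleton_iff] at hx
    rcases hx with rfl | rfl | rfl
    · exact cross_self _
    · simp [F.vec_left, cross]
    · simp [F.vec_right, cross]
  have hiff : A.SSameSide (circumcenter {v, y, p, q}) y ↔
      0 < cross (F.vec v) C / cross (F.vec v) (F.vec y) := by
    have hm : midpoint ℝ p q ∈ A := midpoint_mem_affineSpan (by simp) (by simp)
    obtain ⟨k, hk⟩ : ∃ k : ℝ, C = (cross (F.vec v) C / cross (F.vec v) (F.vec y)) • F.vec y +
        k • F.vec v := by
      refine ⟨cross C (F.vec y) / cross (F.vec v) (F.vec y), ?_⟩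
      apply Complex.ext
      · simp only [Complex.add_re, Complex.real_smul, Complex.mul_re, Complex.ofReal_re,
            Complex.ofReal_im]
        field_simp
        simp only [cross]
        ring
      · simp only [Complex.add_im, Complex.real_smul, Complex.mul_im, Complex.ofReal_re,
            Complex.ofReal_im]
        field_simp
        simp only [cross]
        ring
    set r := cross (F.vec v) C / cross (F.vec v) (F.vec y) with hr
    obtain ⟨t, ht⟩ := F.exists_eq (r • (y - midpoint ℝ p q) + k • (v - midpoint ℝ p q))
    rw [map_add, map_smul, map_smul] at ht
    change _ = F.ofPlane (r • F.vec y + k • F.vec v) + _ at ht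
    rw [← hk] at ht
    refine sSameSide_iff_of_sub_eq (add_smul_mem_affineSpan (p := p) (q := q) (by simp) (by simp)
      (add_smul_sub_midpoint_mem_affineSpan (p := p) (q := q) (v := v) (by simp) (by simp)
        (by simp) hm k) (-t)) hm hnot ?_
    rw [hC]
    refine sub_eq_zero.1 (Eq.trans ?_ (sub_eq_zero.2 ht.symm))
    module
  rw [stepSign]
  refine if_congr ?_ rfl rfl
  rw [← hiff]
  constructor
  · intro H
    exact H y (by simp) (by simp [h.ne.symm, h.right_ne_left, h.right_ne_right])
  · intro H x hx hx'
    rw [Finset.insert_comm, Finset.mem_insert] at hx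
    rcases hx with rfl | hx
    · exact H
    · exact absurd hx hx'

/-- The sign convention `-1` at zero is harmless for a factor multiplied by an area proportional to
`|x|`. -/
lemma ite_mul_abs (x : ℝ) : (if 0 < x then 1 else -1) * |x| = x := by
  split_ifs with h
  · rw [abs_of_pos h, one_mul]
  · rw [abs_of_nonpos (not_lt.1 h)]
    ring

lemma norm_eq_sqrt_dot (z : ℂ) : ‖z‖ = √(dot z z) := by
  rw [Complex.norm_eq_sqrt_sq_add_sq, dot, sq, sq]

/-- The signed area of an elementary dual triangle, in plane coordinates. -/
lemma IsSector.elementaryArea_eq (h : IsSector K p q v y) (hpq : p ≠ q) (F : EdgeFrame p q) {C : ℂ}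
    (hC : circumcenter {v, y, p, q} = midpoint ℝ p q + F.ofPlane C)
    (hCv : dot C (F.vec v) = F.level v) :
    elementaryArea {p, q} {v, p, q} {v, y, p, q} =
      1 / 2 * F.level v * (cross (F.vec v) C / dot (F.vec v) (F.vec v)) *
        SignType.sign (cross (F.vec v) (F.vec y)) := by
  have hcr := h.cross_ne_zero hpq F
  have hv : F.vec v ≠ 0 := by
    intro h0
    simp [h0, cross] at hcr
  have hd := dot_self_pos hv
  rw [elementaryArea, h.isSpoke.stepSign_eq F hv, h.stepSign_eq hpq F hC, triangleArea, hC,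
    h.isSpoke.circumcenter_eq F hv, circumcenter_pair h.isSpoke.pair_mem_faces]
  generalize F.level v = b at *
  generalize F.vec v = w at *
  generalize F.vec y = w' at *
  have hm : midpoint ℝ p q = midpoint ℝ p q + F.ofPlane 0 := by simp
  -- The angle at `c_σ` is right; this covers coinciding centers, as the angle with a zero vector is
  -- `π / 2`.
  have hangle : Real.sin (EuclideanGeometry.angle (midpoint ℝ p q)
      (midpoint ℝ p q + F.ofPlane ((b / dot w w) • w)) (midpoint ℝ p q + F.ofPlane C)) = 1 := by
    rw [EuclideanGeometry.angle, InnerProductGeometry.angle,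
      show inner ℝ (midpoint ℝ p q -ᵥ (midpoint ℝ p q + F.ofPlane ((b / dot w w) • w)))
        ((midpoint ℝ p q + F.ofPlane C) -ᵥ (midpoint ℝ p q + F.ofPlane ((b / dot w w) • w))) = 0
        from ?_]
    · simp
    · rw [vsub_eq_sub, vsub_eq_sub, sub_add_cancel_left, add_sub_add_left_eq_sub, ← map_sub,
        inner_neg_left, F.inner_ofPlane, F.toPlane_ofPlane, neg_eq_zero]
      have : ∀ r : ℝ, dot (r • w) (C - r • w) = r * (dot C w - r * dot w w) := by
        intro r
        simp [dot]
        ring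
      rw [this, div_mul_cancel₀ _ hd.ne', hCv, sub_self, mul_zero]
  have hd1 : dist (midpoint ℝ p q) (midpoint ℝ p q + F.ofPlane ((b / dot w w) • w)) =
      |b| / √(dot w w) := by
    conv_lhs => rw [hm, add_assoc, ← map_add, zero_add]
    rw [F.dist_add_ofPlane, zero_sub, norm_neg, norm_smul, norm_eq_sqrt_dot w, Real.norm_eq_abs,
      abs_div, abs_of_pos hd]
    rw [div_mul_eq_mul_div, div_eq_div_iff hd.ne' (Real.sqrt_pos.2 hd).ne', mul_assoc,
      Real.mul_self_sqrt hd.le]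
  have hd2 : dist (midpoint ℝ p q + F.ofPlane C) (midpoint ℝ p q + F.ofPlane ((b / dot w w) • w)) =
      |cross w C| / √(dot w w) := by
    rw [F.dist_add_ofPlane]
    have : C - (b / dot w w) • w = (cross w C / dot w w) • (Complex.I * w) := by
      apply Complex.ext
      · simp [← hCv]
        field_simp
        simp [dot, cross]
        ring
      · simp [← hCv]
        field_simp
        simp [dot, cross]
        ring
    rw [this, norm_smul, norm_mul, Complex.norm_I, one_mul, norm_eq_sqrt_dot w, Real.norm_eq_abs,
      abs_div, abs_of_pos hd]
    rw [div_mul_eq_mul_div, div_eq_div_iff hd.ne' (Real.sqrt_pos.2 hd).ne', mul_assoc,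
      Real.mul_self_sqrt hd.le]
  rw [hangle, hd1, hd2]
  have h1 := ite_mul_abs b
  have h2 := ite_mul_abs (cross w C / cross w w')
  rw [abs_div, mul_div_assoc', div_eq_div_iff (abs_pos.2 hcr).ne' hcr] at h2
  have h3 : (SignType.sign (cross w w') : ℝ) * |cross w w'| = cross w w' := _root_.sign_mul_abs _
  have h4 : ((SignType.sign (cross w w') : ℝ)) * (SignType.sign (cross w w') : ℝ) = 1 := by
    rcases hcr.lt_or_gt with h | h
    · simp [sign_neg h]
    · simp [sign_pos h]
  have h5 : (if 0 < cross w C / cross w w' then 1 else -1) * |cross w C| =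
      cross w C * SignType.sign (cross w w') := by
    have := abs_pos.2 hcr
    have h6 : ((if 0 < cross w C / cross w w' then 1 else -1) * |cross w C| -
        cross w C * SignType.sign (cross w w')) * cross w w' = 0 := by
      rw [sub_mul, h2]
      linear_combination cross w C * (SignType.sign (cross w w') : ℝ) * h3 -
        cross w C * |cross w w'| * h4
    rcases mul_eq_zero.1 h6 with h | h
    · linarith
    · exact absurd h hcr
  have h7 := Real.mul_self_sqrt hd.le
  have h8 := (Real.sqrt_pos.2 hd).ne'
  calc _ = 1 / 2 * ((if 0 < b then 1 else -1) * |b|) *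
        ((if 0 < cross w C / cross w w' then 1 else -1) * |cross w C|) /
        (√(dot w w) * √(dot w w)) := by field_simp
    _ = _ := by
      rw [h1, h5, h7]
      ring

end Centers

/-! ### Polygons with supporting lines -/

lemma finRotate_val {n : ℕ} (i : Fin n) :
    (finRotate n i : ℕ) = if (i : ℕ) + 1 = n then 0 else (i : ℕ) + 1 := by
  obtain _ | n := n
  · exact i.elim0
  · rw [coe_finRotate]
    simp [Fin.ext_iff]

lemma apply_finRotate {α : Type*} {n : ℕ} {f : ℕ → α} (hf : ∀ i, f (i + n) = f i) (i : Fin n) :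
    f (finRotate n i) = f (i + 1) := by
  rw [finRotate_val]
  split_ifs with hi
  · rw [hi, ← hf 0, zero_add]
  · rfl

lemma finRotate_ne {n : ℕ} (hn : 3 ≤ n) (i : Fin n) : finRotate n i ≠ i := by
  intro h
  have h1 := congrArg Fin.val h
  have h2 := i.2
  rw [finRotate_val] at h1
  split_ifs at h1 <;> omega

lemma finRotate_finRotate_ne {n : ℕ} (hn : 3 ≤ n) (i : Fin n) :
    finRotate n (finRotate n i) ≠ i := by
  intro h
  have h1 := congrArg Fin.val h
  have h2 := i.2
  rw [finRotate_val, finRotate_val] at h1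
  split_ifs at h1 <;> omega

/-- A polygon is simple if each side lies on the zero set of an affine function that is positive at
all vertices other than the endpoints of the side. -/
lemma isSimple_of_pos {n : ℕ} (hn : 3 ≤ n) (P : Polygon E3 n) (g : Fin n → E3 → ℝ)
    (hg : ∀ i x y t, g i (AffineMap.lineMap x y t) = (1 - t) * g i x + t * g i y)
    (h0 : ∀ i, g i (P i) = 0) (h1 : ∀ i, g i (P (finRotate n i)) = 0)
    (hpos : ∀ i j, j ≠ i → j ≠ finRotate n i → 0 < g i (P j)) : IsSimple P := by
  refine ⟨hn, ?_, ?_⟩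
  · intro i j hij
    by_contra hne
    have key : ∀ i j, P i = P j → i ≠ j → j = finRotate n i := by
      intro i j hij hne
      by_contra hj
      have := hpos i j (Ne.symm hne) hj
      rw [← hij, h0] at this
      exact absurd this (lt_irrefl _)
    have hj := key i j hij hne
    have hi := key j i hij.symm (Ne.symm hne)
    rw [hj] at hi
    exact finRotate_finRotate_ne hn i hi.symm
  · rintro i j hne x ⟨⟨t, -, rfl⟩, s, ⟨hs0, hs1⟩, hs⟩
    have hz : (1 - s) * g i (P j) + s * g i (P (finRotate n j)) = 0 := by
      rw [← hg, hs, hg, h0, h1]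
      ring
    rw [← hs]
    by_cases hj : j = finRotate n i
    · left
      refine ⟨hj, ?_⟩
      have hp := hpos i (finRotate n j) (hj ▸ finRotate_finRotate_ne hn i)
        (hj ▸ finRotate_ne hn (finRotate n i))
      rw [hj, h1, ← hj, mul_zero, zero_add] at hz
      rw [(mul_eq_zero.1 hz).resolve_right hp.ne', AffineMap.lineMap_apply_zero]
    have hp := hpos i j hne.symm hj
    by_cases hi : i = finRotate n j
    · right
      refine ⟨hi, ?_⟩
      rw [← hi, h0, mul_zero, add_zero] at hz
      have hs' := (mul_eq_zero.1 hz).resolve_right hp.ne'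
      rw [show s = 1 by linarith, AffineMap.lineMap_apply_one, hi]
    · have hp' := hpos i (finRotate n j) (Ne.symm hi)
        (fun h ↦ hne ((finRotate n).injective h).symm)
      have h2 := mul_nonneg (sub_nonneg.2 hs1) hp.le
      have h3 := mul_nonneg hs0 hp'.le
      have h4 : s = 0 := (mul_eq_zero.1 (by linarith)).resolve_right hp'.ne'
      rw [h4] at hz
      linarith

lemma EdgeFrame.isPlanar {p q : E3} (F : EdgeFrame p q) {n : ℕ} (P : Polygon E3 n) (m : E3)
    (C : Fin n → ℂ) (hP : ∀ i, P i = m + F.ofPlane (C i)) : IsPlanar P := by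
  have hle : vectorSpan ℝ (Set.range P.vertices) ≤ LinearMap.range F.ofPlane := by
    rw [vectorSpan, Submodule.span_le]
    rintro - ⟨-, ⟨i, rfl⟩, -, ⟨j, rfl⟩, rfl⟩
    refine ⟨C i - C j, ?_⟩
    change _ = P i -ᵥ P j
    rw [hP, hP, map_sub, vsub_eq_sub, add_sub_add_left_eq_sub]
  rw [IsPlanar, Coplanar]
  refine (Submodule.rank_mono hle).trans ((LinearMap.rank_le_domain _).trans ?_)
  rw [Complex.rank_real_complex]

/-- A polygon in a plane is convex if each side is perpendicular to a plane vector `w i` whose inner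
product with the vertices is smaller at all vertices other than the endpoints of the side. -/
lemma EdgeFrame.isConvex {p q : E3} (F : EdgeFrame p q) {n : ℕ} (P : Polygon E3 n) (m : E3)
    (C w : Fin n → ℂ) (b l : Fin n → ℝ) (hP : ∀ i, P i = m + F.ofPlane (C i))
    (hb : ∀ i, dot (C i) (w i) = b i) (hw : ∀ i, w i ≠ 0) (hl : ∀ i, 0 < l i)
    (hstep : ∀ i, C (finRotate n i) - C i = l i • (Complex.I * w i))
    (hlt : ∀ i j, j ≠ i → j ≠ finRotate n i → dot (C j) (w i) < b i) : IsConvex P := by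
  intro i j k hji hjr hki hkr
  have hj := hlt i j hji hjr
  have hk := hlt i k hki hkr
  have hd := dot_self_pos (hw i)
  have hPi : P i ∈ affineSpan ℝ {P i, P (finRotate n i)} := left_mem_affineSpan_pair _ _ _
  -- The ratio of the distances of the two vertices from the line through the side.
  let t := (b i - dot (C j) (w i)) / (b i - dot (C k) (w i))
  have ht : 0 < t := div_pos (by linarith) (by linarith)
  have htk : t * (b i - dot (C k) (w i)) = b i - dot (C j) (w i) :=
    div_mul_cancel₀ _ (sub_pos.2 hk).ne'
  let r := cross (w i) (C j - C i - t • (C k - C i)) / dot (w i) (w i)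
  have hr : r * dot (w i) (w i) = cross (w i) (C j - C i - t • (C k - C i)) :=
    div_mul_cancel₀ _ hd.ne'
  have hz : C j - C i - t • (C k - C i) = r • (Complex.I * w i) := by
    refine eq_of_dot_eq_of_cross_eq hd ?_ ?_
    · rw [← hb i] at htk
      simp only [dot, Complex.sub_re, Complex.sub_im, Complex.real_smul, Complex.mul_re,
        Complex.mul_im, Complex.ofReal_re, Complex.ofReal_im, Complex.I_re, Complex.I_im] at htk ⊢
      linear_combination htk
    · rw [← hr]
      simp only [dot, cross, Complex.real_smul, Complex.mul_re,
        Complex.mul_im, Complex.ofReal_re, Complex.ofReal_im, Complex.I_re, Complex.I_im]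
      ring
  have hz' : C j - C i - t • (C k - C i) = (r / l i) • (C (finRotate n i) - C i) := by
    rw [hz, hstep, smul_smul, div_mul_cancel₀ _ (hl i).ne']
  have hmem : P i + (r / l i) • (P (finRotate n i) - P i) ∈
      affineSpan ℝ {P i, P (finRotate n i)} := by
    have := AffineMap.lineMap_mem_affineSpan_pair (r / l i) (P i) (P (finRotate n i))
    rwa [AffineMap.lineMap_apply, vsub_eq_sub, vadd_eq_add, add_comm] at this
  refine (sSameSide_iff_of_sub_eq hmem hPi ?_ (t := t) ?_).2 ht
  · intro hm
    let f : E3 →ₗ[ℝ] ℝ :=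
      { toFun := fun x ↦ dot (F.toPlane x) (w i)
        map_add' := fun a b ↦ by simp only [dot, map_add, Complex.add_re, Complex.add_im]; ring
        map_smul' := fun a b ↦ by simp [dot]; ring }
    have hf : ∀ j, f (P j - P i) = dot (C j) (w i) - b i := by
      intro j
      change dot (F.toPlane (P j - P i)) (w i) = _
      rw [hP, hP, add_sub_add_left_eq_sub, ← map_sub, F.toPlane_ofPlane, ← hb i]
      simp only [dot, Complex.sub_re, Complex.sub_im]
      ring
    have := mem_ker_of_mem_affineSpan f (P i) ?_ hm
    · rw [hf] at this
      linarith
    · intro x hx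
      rcases hx with rfl | rfl
      · rw [sub_self, map_zero]
      · change dot (F.toPlane (P (finRotate n i) - P i)) (w i) = 0
        rw [hP, hP, add_sub_add_left_eq_sub, ← map_sub, F.toPlane_ofPlane, hstep]
        simp [dot]
        ring
  · have := congrArg F.ofPlane hz'
    simp only [map_sub, map_smul] at this
    rw [hP, hP, hP, hP]
    refine sub_eq_zero.1 (Eq.trans ?_ (sub_eq_zero.2 this))
    module

/-! ### The dual polygon of an internal edge -/

section Main

open Classical

variable {K : SimplicialComplex ℝ E3} {p q : E3}

/-- A numbering, periodic with period `n`, of the link of the edge `pq`: consecutive vertices span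
tetrahedra with `pq`, and turn counterclockwise around it. -/
structure IsLinkCycle (K : SimplicialComplex ℝ E3) {p q : E3} (F : EdgeFrame p q) (n : ℕ)
    (v : ℕ → E3) (θ : ℕ → ℝ) : Prop where
  isTurn : IsTurn n (fun i ↦ F.vec (v i)) θ
  isSector : ∀ i, IsSector K p q (v i) (v (i + 1))
  periodic : ∀ i, v (i + n) = v i
  bijOn : Set.BijOn (fun i : Fin n ↦ v i) Set.univ {x | IsSpoke K p q x}

lemma exists_isLinkCycle (hK : IsTetrahedralMesh K) (hpq : p ≠ q) (hτ : {p, q} ∈ K.faces)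
    (hint : IsInternal K {p, q}) (F : EdgeFrame p q) : ∃ n v θ, IsLinkCycle K F n v θ := by
  have hfin : {x | IsSpoke K p q x}.Finite := by
    refine Set.Finite.of_finite_image (f := fun x ↦ ({x, p, q} : Finset E3))
      (hK.finite.subset ?_) ?_
    · rintro - ⟨x, hx, rfl⟩
      exact hx.mem_faces
    · intro x hx y hy hxy
      have h1 : x ∈ ({y, p, q} : Finset E3) := by
        have h2 : ({x, p, q} : Finset E3) = {y, p, q} := hxy
        rw [← h2]
        exact Finset.mem_insert_self _ _
      simpa [hx.ne_left, hx.ne_right] using h1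
  have : Finite {x // IsSpoke K p q x} := hfin
  have : Nonempty {x // IsSpoke K p q x} := by
    obtain ⟨ρ, hρ⟩ := hK.pure _ hτ
    obtain ⟨x, y, h, -⟩ := exists_isSector_of_mem_incident hpq hρ
    exact ⟨⟨x, h.isSpoke⟩⟩
  choose s hs hspos using fun x : {x // IsSpoke K p q x} ↦ (x.2.exists_isSector hpq F hint).1
  obtain ⟨n, e, θ, hT, hsucc, hper, hbij⟩ := exists_isTurn
    (fun x : {x // IsSpoke K p q x} ↦ F.vec x) (fun x ↦ ⟨s x, (hs x).symm.isSpoke⟩) hspos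
    (fun x u h1 h2 ↦ by
      simp only [Subtype.ext_iff]
      exact (hs x).eq_or_eq hpq F u.2 (hspos x) h1 h2)
  refine ⟨n, fun i ↦ e i, θ, hT, fun i ↦ ?_, fun i ↦ by rw [hper], ?_, ?_, ?_⟩
  · rw [← hsucc]
    exact hs _
  · exact fun i _ ↦ (e i).2
  · exact fun i _ j _ hij ↦ hbij.1 (Subtype.ext hij)
  · intro x hx
    obtain ⟨i, hi⟩ := hbij.2 ⟨x, hx⟩
    exact ⟨i, trivial, congrArg Subtype.val hi⟩

namespace IsLinkCycle

variable {F : EdgeFrame p q} {n : ℕ} {v : ℕ → E3} {θ : ℕ → ℝ}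

/-- The `i`-th tetrahedron around the edge. -/
noncomputable def tet (_ : IsLinkCycle K F n v θ) (i : ℕ) : Finset E3 := {v i, v (i + 1), p, q}

/-- The triangle shared by the tetrahedra `i` and `i + 1` around the edge. -/
noncomputable def tri (_ : IsLinkCycle K F n v θ) (i : ℕ) : Finset E3 := {v (i + 1), p, q}

/-- The plane coordinates of the circumcenter of the `i`-th tetrahedron. -/
noncomputable def center (h : IsLinkCycle K F n v θ) (i : ℕ) : ℂ := F.vec (circumcenter (h.tet i))

/-- The signed length of the side from `center i` to `center (i + 1)`, in units of the normal vector
of that side. -/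
noncomputable def side (h : IsLinkCycle K F n v θ) (i : ℕ) : ℝ :=
  cross (F.vec (v (i + 1))) (h.center (i + 1) - h.center i) /
    dot (F.vec (v (i + 1))) (F.vec (v (i + 1)))

lemma eq_of_eq (h : IsLinkCycle K F n v θ) {i j : Fin n} (hij : v i = v j) : i = j :=
  h.bijOn.injOn trivial trivial hij

lemma isSpoke (h : IsLinkCycle K F n v θ) (i : ℕ) : IsSpoke K p q (v i) := (h.isSector i).isSpoke

lemma vec_ne_zero (h : IsLinkCycle K F n v θ) (i : ℕ) : F.vec (v i) ≠ 0 :=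
  norm_pos_iff.1 (h.isTurn.norm_pos i)

lemma tet_periodic (h : IsLinkCycle K F n v θ) (i : ℕ) : h.tet (i + n) = h.tet i := by
  rw [tet, tet, add_right_comm, h.periodic, h.periodic]

lemma center_periodic (h : IsLinkCycle K F n v θ) (i : ℕ) : h.center (i + n) = h.center i := by
  rw [center, center, tet_periodic]

lemma ne_add_two (h : IsLinkCycle K F n v θ) (i : ℕ) : v i ≠ v (i + 2) := by
  intro hv
  have h1 := h.isTurn.cross_pos i
  have h2 := h.isTurn.cross_pos (i + 1)
  simp only [add_assoc, Nat.reduceAdd] at h1 h2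
  rw [← hv, cross_swap] at h2
  linarith

lemma tet_mem_incident (h : IsLinkCycle K F n v θ) (hpq : p ≠ q) (i : ℕ) :
    h.tet i ∈ incident K (h.tri i) 4 := by
  have := (h.isSector i).symm.mem_incident hpq
  rwa [Finset.insert_comm (v (i + 1)) (v i)] at this

lemma tet_succ_mem_incident (h : IsLinkCycle K F n v θ) (hpq : p ≠ q) (i : ℕ) :
    h.tet (i + 1) ∈ incident K (h.tri i) 4 :=
  (h.isSector (i + 1)).mem_incident hpq

lemma notMem_tet (h : IsLinkCycle K F n v θ) (i : ℕ) : v (i + 2) ∉ h.tet i := by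
  have h1 := h.ne_add_two i
  have h2 := (h.isSector (i + 1)).ne
  have h3 := (h.isSector (i + 1)).right_ne_left
  have h4 := (h.isSector (i + 1)).right_ne_right
  simp only [add_assoc, Nat.reduceAdd] at h2 h3 h4
  simp [tet, h1.symm, h2.symm, h3, h4]

lemma mem_tet_succ (h : IsLinkCycle K F n v θ) (i : ℕ) : v (i + 2) ∈ h.tet (i + 1) := by
  simp [tet]

lemma tet_ne_succ (h : IsLinkCycle K F n v θ) (i : ℕ) : h.tet i ≠ h.tet (i + 1) := by
  intro he
  exact h.notMem_tet i (he ▸ h.mem_tet_succ i)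

lemma incident_tri (h : IsLinkCycle K F n v θ) (hpq : p ≠ q) (i : ℕ) :
    incident K (h.tri i) 4 = {h.tet i, h.tet (i + 1)} := by
  refine Set.Subset.antisymm ?_ ?_
  · intro ρ hρ
    obtain ⟨y, hy, rfl⟩ := (h.isSpoke (i + 1)).exists_isSector_of_mem_incident hpq hρ
    rcases (hy.cross_ne_zero hpq F).lt_or_gt with hc | hc
    · have hc' := h.isTurn.cross_pos i
      rw [cross_swap, Left.neg_pos_iff] at hc'
      rw [hy.eq_of_cross_neg (h.isSector i).symm hpq F hc hc', Finset.insert_comm]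
      exact Set.mem_insert _ _
    · rw [hy.eq_of_cross_pos (h.isSector (i + 1)) hpq F hc (h.isTurn.cross_pos (i + 1))]
      exact Set.mem_insert_of_mem _ rfl
  · rintro ρ (rfl | rfl)
    · exact h.tet_mem_incident hpq i
    · exact h.tet_succ_mem_incident hpq i

lemma bijOn_tri (h : IsLinkCycle K F n v θ) (hpq : p ≠ q) :
    Set.BijOn (fun i : Fin n ↦ h.tri i) Set.univ (incident K {p, q} 3) := by
  refine ⟨fun i _ ↦ (h.isSpoke (i + 1)).mem_incident hpq, ?_, ?_⟩
  · intro i _ j _ hij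
    have h1 : v (i + 1) ∈ h.tri j := by
      have h2 : h.tri i = h.tri j := hij
      rw [← h2]
      exact Finset.mem_insert_self _ _
    rw [tri] at h1
    have h2 : v (i + 1) = v (j + 1) := by
      simpa [(h.isSpoke (i + 1)).ne_left, (h.isSpoke (i + 1)).ne_right] using h1
    rw [← apply_finRotate h.periodic, ← apply_finRotate h.periodic] at h2
    exact (finRotate n).injective (h.eq_of_eq h2)
  · intro σ hσ
    obtain ⟨x, hx, rfl⟩ := exists_isSpoke_of_mem_incident hpq hσ
    obtain ⟨j, -, rfl⟩ := h.bijOn.surjOn hx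
    obtain ⟨i, rfl⟩ := (finRotate n).surjective j
    refine ⟨i, trivial, ?_⟩
    simp only [tri]
    rw [apply_finRotate h.periodic]

lemma bijOn_tet (h : IsLinkCycle K F n v θ) (hpq : p ≠ q) :
    Set.BijOn (fun i : Fin n ↦ h.tet i) Set.univ (incident K {p, q} 4) := by
  refine ⟨fun i _ ↦ ⟨(h.isSector i).mem_faces, fun x hx ↦ ?_, (h.isSector i).card_eq hpq⟩, ?_, ?_⟩
  · exact Finset.mem_insert_of_mem (Finset.mem_insert_of_mem hx)
  · intro i _ j _ hij
    have h0 : h.tet i = h.tet j := hij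
    have h1 : v i ∈ h.tet j := h0 ▸ Finset.mem_insert_self _ _
    have h2 : v j ∈ h.tet i := h0 ▸ Finset.mem_insert_self _ _
    simp only [tet, Finset.mem_insert, Finset.mem_singleton, (h.isSpoke i).ne_left,
      (h.isSpoke i).ne_right, (h.isSpoke j).ne_left, (h.isSpoke j).ne_right, or_false] at h1 h2
    rcases h1 with h1 | h1
    · exact h.eq_of_eq h1
    · rcases h2 with h2 | h2
      · exact (h.eq_of_eq h2).symm
      · have h3 := h.isTurn.cross_pos i
        have h4 := h.isTurn.cross_pos j
        rw [← h1, h2, cross_swap] at h4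
        linarith
  · intro ρ hρ
    have key : ∀ x y, IsSector K p q x y → 0 < cross (F.vec x) (F.vec y) →
        ∃ i : Fin n, h.tet i = {x, y, p, q} := by
      intro x y hxy hc
      obtain ⟨i, -, rfl⟩ := h.bijOn.surjOn hxy.isSpoke
      refine ⟨i, ?_⟩
      rw [tet, hxy.eq_of_cross_pos (h.isSector i) hpq F hc (h.isTurn.cross_pos i)]
    obtain ⟨x, y, hxy, rfl⟩ := exists_isSector_of_mem_incident hpq hρ
    rcases (hxy.cross_ne_zero hpq F).lt_or_gt with hc | hc
    · rw [cross_swap, Left.neg_neg_iff] at hc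
      obtain ⟨i, hi⟩ := key y x hxy.symm hc
      exact ⟨i, trivial, hi.trans (Finset.insert_comm _ _ _)⟩
    · obtain ⟨i, hi⟩ := key x y hxy hc
      exact ⟨i, trivial, hi⟩

lemma circumcenter_tet (h : IsLinkCycle K F n v θ) (hpq : p ≠ q) (i : ℕ) :
    circumcenter (h.tet i) = midpoint ℝ p q + F.ofPlane (h.center i) :=
  ((h.isSector i).circumcenter_spec hpq F).1

lemma dot_center (h : IsLinkCycle K F n v θ) (hpq : p ≠ q) (i : ℕ) :
    dot (h.center i) (F.vec (v i)) = F.level (v i) :=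
  ((h.isSector i).circumcenter_spec hpq F).2.1

lemma dot_center_succ (h : IsLinkCycle K F n v θ) (hpq : p ≠ q) (i : ℕ) :
    dot (h.center i) (F.vec (v (i + 1))) = F.level (v (i + 1)) :=
  ((h.isSector i).circumcenter_spec hpq F).2.2.1

/-- The Delaunay condition for the triangle shared by the tetrahedra `i` and `i + 1`. -/
lemma dot_center_add_two (h : IsLinkCycle K F n v θ) (hpq : p ≠ q) (hD : IsPairwiseDelaunay K)
    (i : ℕ) : dot (h.center i) (F.vec (v (i + 2))) < F.level (v (i + 2)) := by
  refine (((h.isSector i).circumcenter_spec hpq F).2.2.2 _).1 ?_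
  have hs := (h.isSpoke (i + 1)).mem_incident hpq
  exact hD (h.tri i) hs.1 hs.2.2 _ (h.tet_mem_incident hpq i) _ (h.tet_succ_mem_incident hpq i)
    (h.tet_ne_succ i) _ (h.mem_tet_succ i) fun hm ↦ h.notMem_tet i
      ((h.tet_mem_incident hpq i).2.1 hm)

lemma center_step (h : IsLinkCycle K F n v θ) (hpq : p ≠ q) (i : ℕ) :
    h.center (i + 1) - h.center i = h.side i • (Complex.I * F.vec (v (i + 1))) := by
  have hd := dot_self_pos (h.vec_ne_zero (i + 1))
  have h1 := h.dot_center_succ hpq i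
  have h2 := h.dot_center hpq (i + 1)
  have h3 : h.side i * dot (F.vec (v (i + 1))) (F.vec (v (i + 1))) =
      cross (F.vec (v (i + 1))) (h.center (i + 1) - h.center i) := div_mul_cancel₀ _ hd.ne'
  refine eq_of_dot_eq_of_cross_eq hd ?_ ?_
  · rw [← h2] at h1
    simp only [dot, Complex.sub_re, Complex.sub_im, Complex.real_smul, Complex.mul_re,
      Complex.mul_im, Complex.ofReal_re, Complex.ofReal_im, Complex.I_re, Complex.I_im] at h1 ⊢
    linear_combination -h1
  · rw [← h3]
    simp only [dot, cross, Complex.real_smul, Complex.mul_re,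
      Complex.mul_im, Complex.ofReal_re, Complex.ofReal_im, Complex.I_re, Complex.I_im]
    ring

lemma dot_center_step (h : IsLinkCycle K F n v θ) (hpq : p ≠ q) (i : ℕ) (x : ℂ) :
    dot (h.center (i + 1)) x = dot (h.center i) x + h.side i * cross (F.vec (v (i + 1))) x := by
  rw [sub_eq_iff_eq_add.1 (h.center_step hpq i)]
  simp only [dot, cross, Complex.add_re, Complex.add_im, Complex.real_smul, Complex.mul_re,
    Complex.mul_im, Complex.ofReal_re, Complex.ofReal_im, Complex.I_re, Complex.I_im]
  ring

lemma side_pos (h : IsLinkCycle K F n v θ) (hpq : p ≠ q) (hD : IsPairwiseDelaunay K) (i : ℕ) :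
    0 < h.side i := by
  have h1 := h.dot_center_add_two hpq hD i
  have h2 := h.dot_center_succ hpq (i + 1)
  have h3 := h.isTurn.cross_pos (i + 1)
  rw [h.dot_center_step hpq] at h2
  simp only [add_assoc, Nat.reduceAdd] at h2 h3
  exact (mul_pos_iff_of_pos_right h3).1 (by linarith)

lemma dot_center_lt (h : IsLinkCycle K F n v θ) (hpq : p ≠ q) (hD : IsPairwiseDelaunay K)
    (i : ℕ) {k : ℕ} (hk : 1 ≤ k) (hkn : k + 2 ≤ n) :
    dot (h.center (i + k)) (F.vec (v i)) < F.level (v i) :=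
  h.isTurn.dot_lt (b := fun i ↦ F.level (v i)) h.center_periodic (h.side_pos hpq hD)
    (h.dot_center_step hpq) (h.dot_center hpq) (h.dot_center_succ hpq) i hk hkn

lemma dot_center_lt_of_ne (h : IsLinkCycle K F n v θ) (hpq : p ≠ q) (hD : IsPairwiseDelaunay K)
    (i j : Fin n) (hij : j ≠ i) (hij' : j ≠ finRotate n i) :
    dot (h.center j) (F.vec (v (i + 1))) < F.level (v (i + 1)) := by
  have h1 : (j : ℕ) ≠ i := fun e ↦ hij (Fin.ext e)
  have h2 : (j : ℕ) ≠ (finRotate n i : Fin n) := fun e ↦ hij' (Fin.ext e)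
  have h3 := i.2
  have h4 := j.2
  rw [finRotate_val] at h2
  rcases Nat.lt_or_ge j i with hlt | hge
  · have h5 := h.dot_center_lt hpq hD (i + 1) (k := j + n - (i + 1))
      (by split_ifs at h2 <;> omega) (by omega)
    rwa [show (i : ℕ) + 1 + (j + n - (i + 1)) = j + n by omega, h.center_periodic] at h5
  · have h5 := h.dot_center_lt hpq hD (i + 1) (k := j - (i + 1))
      (by split_ifs at h2 <;> omega) (by omega)
    rwa [show (i : ℕ) + 1 + (j - (i + 1)) = j by split_ifs at h2 <;> omega] at h5

/-- The two elementary dual triangles at a triangle `σ` of the mesh add up to the signed area of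
the triangle spanned by `c_τ` and the side of the dual polygon belonging to `σ`. -/
lemma elementaryArea_add (h : IsLinkCycle K F n v θ) (hpq : p ≠ q) (i : ℕ) :
    ∑ᶠ ρ ∈ incident K (h.tri i) 4, elementaryArea {p, q} (h.tri i) ρ =
      1 / 2 * (h.side i * F.level (v (i + 1))) := by
  rw [h.incident_tri hpq, finsum_mem_pair (h.tet_ne_succ i)]
  have h1 := (h.isSector (i + 1)).elementaryArea_eq hpq F (h.circumcenter_tet hpq (i + 1))
    (h.dot_center hpq (i + 1))
  have hc := h.circumcenter_tet hpq i
  rw [tet, Finset.insert_comm] at hc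
  have h2 := (h.isSector i).symm.elementaryArea_eq hpq F hc (h.dot_center_succ hpq i)
  rw [sign_pos (h.isTurn.cross_pos (i + 1))] at h1
  rw [Finset.insert_comm (v (i + 1)) (v i), cross_swap (F.vec (v (i + 1))) (F.vec (v i)),
    sign_neg (neg_neg_of_pos (h.isTurn.cross_pos i))] at h2
  have hs : cross (F.vec (v (i + 1))) (h.center (i + 1) - h.center i) =
      cross (F.vec (v (i + 1))) (h.center (i + 1)) - cross (F.vec (v (i + 1))) (h.center i) := by
    simp only [cross, Complex.sub_re, Complex.sub_im]
    ring
  rw [side, hs]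
  rw [tri, tet, tet, h1, h2]
  simp only [SignType.coe_one, SignType.coe_neg]
  ring

lemma dualSignedArea_eq (h : IsLinkCycle K F n v θ) (hpq : p ≠ q) :
    dualSignedArea K {p, q} = ∑ i ∈ Finset.range n, 1 / 2 * (h.side i * F.level (v (i + 1))) := by
  rw [dualSignedArea, ← finsum_mem_eq_of_bijOn _ (h.bijOn_tri hpq) fun i _ ↦ rfl, finsum_mem_univ,
    finsum_eq_sum_of_fintype, Finset.sum_range]
  exact Finset.sum_congr rfl fun i _ ↦ h.elementaryArea_add hpq i

/-- The sides of the closed polygon add up to zero. -/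
lemma sum_side_mul_dot (h : IsLinkCycle K F n v θ) (hpq : p ≠ q) (y : ℂ) :
    ∑ i ∈ Finset.range n, h.side i * dot y (F.vec (v (i + 1))) = 0 := by
  have key : ∀ i, h.side i * dot y (F.vec (v (i + 1))) =
      dot (h.center (i + 1)) (Complex.I * y) - dot (h.center i) (Complex.I * y) := by
    intro i
    rw [h.dot_center_step hpq]
    simp only [dot, cross, Complex.mul_re, Complex.mul_im, Complex.I_re, Complex.I_im]
    ring
  simp only [key]
  rw [Finset.sum_range_sub (fun i ↦ dot (h.center i) (Complex.I * y)), ← h.center_periodic 0,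
    zero_add, sub_self]

/-- By the vanishing of the sum of the sides, the signed area does not change when the apex `c_τ` is
moved to a vertex of the polygon, from where every side is seen positively oriented. -/
lemma dualSignedArea_pos (h : IsLinkCycle K F n v θ) (hpq : p ≠ q) (hD : IsPairwiseDelaunay K) :
    0 < dualSignedArea K {p, q} := by
  have hn := h.isTurn.three_le
  have key : dualSignedArea K {p, q} = 1 / 2 * ∑ i ∈ Finset.range n,
      h.side i * (F.level (v (i + 1)) - dot (h.center 0) (F.vec (v (i + 1)))) := by
    rw [h.dualSignedArea_eq hpq, ← Finset.mul_sum]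
    simp only [mul_sub, Finset.sum_sub_distrib]
    rw [h.sum_side_mul_dot hpq, mul_zero, sub_zero]
  have hpos : ∀ i, 1 ≤ i → i + 2 ≤ n →
      0 < h.side i * (F.level (v (i + 1)) - dot (h.center 0) (F.vec (v (i + 1)))) := by
    intro i h1 h2
    have h3 := h.dot_center_lt hpq hD (i + 1) (k := n - (i + 1)) (by omega) (by omega)
    rw [show i + 1 + (n - (i + 1)) = 0 + n by omega, h.center_periodic] at h3
    exact mul_pos (h.side_pos hpq hD i) (sub_pos.2 h3)
  rw [key]
  refine mul_pos (by norm_num) (Finset.sum_pos' ?_ ⟨1, Finset.mem_range.2 (by omega), hpos 1 le_rfl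
    hn⟩)
  intro i hi
  rw [Finset.mem_range] at hi
  rcases Nat.eq_zero_or_pos i with rfl | hi0
  · rw [h.dot_center_succ hpq 0, sub_self, mul_zero]
  · rcases Nat.lt_or_ge (i + 1) n with h1 | h1
    · exact (hpos i hi0 h1).le
    · have h2 := h.dot_center hpq n
      have h3 := h.center_periodic 0
      rw [zero_add] at h3
      rw [h3] at h2
      rw [show i + 1 = n by omega, h2, sub_self, mul_zero]

/-- The circumcentric dual of the edge, as a polygon. -/
noncomputable def dualPolygon (h : IsLinkCycle K F n v θ) : Polygon E3 n :=
  ⟨fun i ↦ circumcenter (h.tet i)⟩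

lemma isDualPolygon (h : IsLinkCycle K F n v θ) (hpq : p ≠ q) :
    IsDualPolygon K {p, q} h.dualPolygon := by
  refine ⟨fun i ↦ h.tet i, fun i ↦ h.tri i, h.bijOn_tet hpq, h.bijOn_tri hpq,
    fun i ↦ ⟨(h.tet_mem_incident hpq i).2.1, ?_⟩, fun _ ↦ rfl⟩
  simp only
  rw [apply_finRotate h.tet_periodic]
  exact (h.tet_succ_mem_incident hpq i).2.1

lemma isSimple (h : IsLinkCycle K F n v θ) (hpq : p ≠ q) (hD : IsPairwiseDelaunay K) :
    IsSimple h.dualPolygon := by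
  have hv : ∀ i : Fin n, F.vec (h.dualPolygon i) = h.center i := fun _ ↦ rfl
  refine isSimple_of_pos h.isTurn.three_le _
    (fun i x ↦ F.level (v (i + 1)) - dot (F.vec x) (F.vec (v (i + 1)))) ?_ ?_ ?_ ?_
  · intro i x y t
    have : F.vec (AffineMap.lineMap x y t) = (1 - t) • F.vec x + t • F.vec y := by
      rw [EdgeFrame.vec, EdgeFrame.vec, EdgeFrame.vec, ← map_smul, ← map_smul, ← map_add,
        AffineMap.lineMap_apply_module]
      congr 1
      module
    rw [this]
    simp only [dot, Complex.add_re, Complex.add_im, Complex.real_smul, Complex.mul_re,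
      Complex.mul_im, Complex.ofReal_re, Complex.ofReal_im]
    ring
  · intro i
    simp only [hv]
    rw [h.dot_center_succ hpq, sub_self]
  · intro i
    simp only [hv]
    rw [apply_finRotate h.center_periodic, h.dot_center hpq, sub_self]
  · intro i j hj hj'
    exact sub_pos.2 (h.dot_center_lt_of_ne hpq hD i j hj hj')

end IsLinkCycle
end Main
end CircumcentricDual

theorem mainTheorem3 (K : Geometry.SimplicialComplex ℝ E3)
    (hK : CircumcentricDual.IsTetrahedralMesh K) (hD : CircumcentricDual.IsPairwiseDelaunay K)
    (τ : Finset E3) (hτ : τ ∈ K.faces) (hcard : τ.card = 2)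
    (hint : CircumcentricDual.IsInternal K τ) :
    (∃ (n : ℕ) (P : Polygon E3 n), CircumcentricDual.IsDualPolygon K τ P ∧
      CircumcentricDual.IsSimple P ∧ CircumcentricDual.IsPlanar P ∧
      CircumcentricDual.IsConvex P) ∧
    0 < CircumcentricDual.dualSignedArea K τ := by
  classical
  obtain ⟨p, q, hpq, rfl⟩ := Finset.card_eq_two.1 hcard
  obtain ⟨F⟩ := CircumcentricDual.exists_edgeFrame hpq
  -- `convert` reconciles the decidability instances hidden in the notation `{p, q}`.
  obtain ⟨n, v, θ, h⟩ := CircumcentricDual.exists_isLinkCycle hK hpq (by convert hτ)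
    (by convert hint) F
  have hP : ∀ i : Fin n, h.dualPolygon i = midpoint ℝ p q + F.ofPlane (h.center i) :=
    fun i ↦ h.circumcenter_tet hpq i
  refine ⟨⟨n, h.dualPolygon, by convert h.isDualPolygon hpq, h.isSimple hpq hD, F.isPlanar _ _ _ hP,
    F.isConvex _ _ _ (fun i ↦ F.vec (v (i + 1))) (fun i ↦ F.level (v (i + 1)))
      (fun i ↦ h.side i) hP (fun i ↦ h.dot_center_succ hpq i) (fun i ↦ h.vec_ne_zero (i + 1))
      (fun i ↦ h.side_pos hpq hD i) (fun i ↦ ?_) (h.dot_center_lt_of_ne hpq hD)⟩, ?_⟩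
  · rw [CircumcentricDual.apply_finRotate h.center_periodic]
    exact h.center_step hpq i
  · convert h.dualSignedArea_pos hpq hD
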